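/- Let $\mathcal G_{n,m}$ be the cylindrical square grid of circumference $n$ and height $m$, i.e. the Cartesian product of a cycle with $n$ vertices and a path with $m$ vertices, drawn in the usual way on a cylinder $S^1\times\mathbb R$. Wire its boundary: add one extra vertex $r$ joined by an edge to every vertex of the lowest row and of the highest row. An essential cycle-rooted spanning forest (essential CRSF) is a spanning subgraph of this wired graph in which the connected component of $r$ is a tree and every other connected component contains exactly one cycle; these cycles are called its loops. It is incompressible if none of its loops is contractible on the cylinder. Let $\mu_{n,m}$ be the uniform probability measure on the (finite) set of incompressible essential CRSFs, and let $N$ be the number of loops. Let $\tau>0$ and $q=e^{\pi\tau}$. Let $n,m\to\infty$ in such a way that $n/m\to\tau$. Then (for $n,m$ large $\mu_{n,m}$ is a well-defined probability measure and) for every $X\in\mathbb C$ the infinite product below converges and $$\mathbb E_{\mu_{n,m}}\bigl[X^{N}\bigr]\;\longrightarrow\; p_\tau(X)=\prod_{j=1}^\infty\frac{q^j+q^{-j}-2+X}{q^j+q^{-j}-1}.$$ In particular the probability $\mu_{n,m}(N=0)$ that there are no loops tends to the constant $p_\tau(0)$, and $p_\tau(0)>0$. -/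

import Mathlib

open Filter Topology MeasureTheory

noncomputable section

namespace CylCRSF

/-! ### The cylindrical grid and its wired version -/

/-- Vertices of the cylindrical grid of circumference `n` and height `m`: column (cyclic), row. -/
abbrev CylVertex (n m : ℕ) : Type := ZMod n × Fin m

/-- The cylindrical square grid: an `n`-cycle times a path with `m` vertices. (For `n ≤ 2` this
simple graph has no parallel edges or self-loops.) -/
def cylGrid (n m : ℕ) : SimpleGraph (CylVertex n m) :=
  SimpleGraph.circulantGraph ({1} : Set (ZMod n)) □ SimpleGraph.pathGraph m

/-- The vertices of the grid together with one extra vertex `none`, the wired boundary. -/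
abbrev WiredVertex (n m : ℕ) : Type := Option (CylVertex n m)

/-- Adjacency in the wired grid: the extra vertex is joined to every vertex of the lowest
and of the highest row. -/
def wiredAdj (n m : ℕ) : WiredVertex n m → WiredVertex n m → Prop
  | some u, some v => (cylGrid n m).Adj u v
  | none, some v => v.2.val = 0 ∨ v.2.val + 1 = m
  | some u, none => u.2.val = 0 ∨ u.2.val + 1 = m
  | none, none => False

/-- The cylindrical grid with wired boundary. -/
def wiredGrid (n m : ℕ) : SimpleGraph (WiredVertex n m) where
  Adj := wiredAdj n m
  symm := ⟨by
    rintro (_ | u) (_ | v) h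
    · exact h
    · exact h
    · exact h
    · exact SimpleGraph.Adj.symm h⟩
  loopless := ⟨by
    rintro (_ | u) h
    · exact h
    · exact (cylGrid n m).irrefl h⟩

/-! ### Cycles and essential cycle-rooted spanning forests -/

/-- The (unoriented, unbased) cycles of `H` that pass through a vertex of `S`, each given by
its set of edges. -/
def cyclesThrough {V : Type*} (H : SimpleGraph V) (S : Set V) : Set (Set (Sym2 V)) :=
  {C | ∃ v ∈ S, ∃ p : H.Walk v v, p.IsCycle ∧ C = {e | e ∈ p.edges}}

/-- The number of loops (cycles) of a subgraph. -/
def numLoops {V : Type*} (H : SimpleGraph V) : ℕ := (cyclesThrough H Set.univ).ncard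

/-- `H` is an essential CRSF of the wired grid: a spanning subgraph whose component containing
the wired boundary vertex is a tree, and each of whose other components has exactly
one cycle. -/
def IsEssentialCRSF (n m : ℕ) (H : SimpleGraph (WiredVertex n m)) : Prop :=
  H ≤ wiredGrid n m ∧
  (∀ c : H.ConnectedComponent, c = H.connectedComponentMk none →
    cyclesThrough H c.supp = ∅) ∧
  (∀ c : H.ConnectedComponent, c ≠ H.connectedComponentMk none →
    ∃! C : Set (Sym2 (WiredVertex n m)), C ∈ cyclesThrough H c.supp)

/-! ### The grid drawn on the cylinder, contractibility -/

/-- The cylinder `ℝ/ℤ × ℝ` in which the grid is drawn. -/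
abbrev Cylinder : Type := UnitAddCircle × ℝ

/-- The position of a vertex: column `x` is at angle `x / n`, row `y` at height `y`. -/
def vertexPos {n m : ℕ} (u : CylVertex n m) : Cylinder :=
  ((((u.1.val : ℝ) / n : ℝ) : UnitAddCircle), (u.2.val : ℝ))

/-- Signed number of columns (`0`, `1` or `-1`) travelled along the edge from `u` to `v`. -/
def hStep {n m : ℕ} (u v : CylVertex n m) : ℤ :=
  if v.1 = u.1 then 0 else if v.1 = u.1 + 1 then 1 else -1

theorem angle_add_one {n : ℕ} (x : ZMod n) :
    ((((x + 1).val : ℝ) / n : ℝ) : UnitAddCircle)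
      = (((x.val : ℝ) / n : ℝ) : UnitAddCircle) + (((1 : ℝ) / n : ℝ) : UnitAddCircle) := by
  rcases Nat.eq_zero_or_pos n with rfl | hn
  · simp
  · have : NeZero n := ⟨hn.ne'⟩
    rw [← ZMod.toAddCircle_apply, ← ZMod.toAddCircle_apply, map_add]
    congr 1
    have := ZMod.toAddCircle_intCast (N := n) 1
    simpa using this

theorem angle_hStep {n m : ℕ} {u v : CylVertex n m} (h : (cylGrid n m).Adj u v) :
    (((u.1.val : ℝ) / n : ℝ) : UnitAddCircle) + (((hStep u v : ℝ) / n : ℝ) : UnitAddCircle)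
      = (((v.1.val : ℝ) / n : ℝ) : UnitAddCircle) := by
  unfold hStep
  split_ifs with h0 h1
  · simp [h0]
  · rw [h1, angle_add_one]; simp
  · have h2 : u.1 = v.1 + 1 := by
      simp only [cylGrid, SimpleGraph.boxProd_adj, SimpleGraph.circulantGraph,
        SimpleGraph.fromRel_adj, Set.mem_singleton_iff] at h
      rcases h with ⟨⟨_, h | h⟩, _⟩ | ⟨_, h⟩
      · rw [← h]; ring
      · exact absurd (by rw [← h]; ring) h1
      · exact absurd h.symm h0
    rw [h2, angle_add_one, add_assoc, ← AddCircle.coe_add]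
    simp [neg_div]

/-- The edge from `u` to `v` as a straight path on the cylinder. -/
def edgePath {n m : ℕ} {u v : CylVertex n m} (h : (cylGrid n m).Adj u v) :
    Path (vertexPos u) (vertexPos v) where
  toFun t := ((((u.1.val : ℝ) / n : ℝ) : UnitAddCircle)
      + (((t : ℝ) * ((hStep u v : ℝ) / n) : ℝ) : UnitAddCircle),
    (1 - (t : ℝ)) * (u.2.val : ℝ) + (t : ℝ) * (v.2.val : ℝ))
  continuous_toFun := by
    have h1 : Continuous fun t : unitInterval =>
        (((t : ℝ) * ((hStep u v : ℝ) / n) : ℝ) : UnitAddCircle) :=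
      (AddCircle.continuous_mk' (1 : ℝ)).comp (by fun_prop)
    exact Continuous.prodMk (continuous_const.add h1) (by fun_prop)
  source' := by simp [vertexPos]
  target' := by
    simp only [Set.Icc.coe_one, one_mul, angle_hStep h]
    simp [vertexPos]

/-- The path on the cylinder traced by a walk in the grid. -/
def walkPath {n m : ℕ} : {u v : CylVertex n m} → (cylGrid n m).Walk u v →
    Path (vertexPos u) (vertexPos v)
  | _, _, .nil => Path.refl _
  | _, _, .cons h p => (edgePath h).trans (walkPath p)

/-- A closed walk in the grid is contractible if the loop it traces is null-homotopic
on the cylinder. -/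
def IsContractible {n m : ℕ} {v : CylVertex n m} (p : (cylGrid n m).Walk v v) : Prop :=
  (walkPath p).Homotopic (Path.refl (vertexPos v))

/-- `H` is incompressible: no cycle of the grid all of whose edges lie in `H` is contractible.
(In an essential CRSF no cycle passes through the wired vertex, so all cycles of `H`
are of this kind.) -/
def IsIncompressible {n m : ℕ} (H : SimpleGraph (WiredVertex n m)) : Prop :=
  ∀ (v : CylVertex n m) (p : (cylGrid n m).Walk v v), p.IsCycle →
    (∀ e ∈ p.edges, e.map some ∈ H.edgeSet) → ¬ IsContractible p

/-! ### The uniform measure and the generating function -/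

/-- The incompressible essential CRSFs of the wired cylindrical grid. -/
def incompressibleCRSFs (n m : ℕ) : Set (SimpleGraph (WiredVertex n m)) :=
  {H | IsEssentialCRSF n m H ∧ IsIncompressible H}

instance instMeasurableSpaceWired (n m : ℕ) :
    MeasurableSpace (SimpleGraph (WiredVertex n m)) := ⊤

/-- The incompressible CRSF measure: the uniform probability measure on the (finite) set of
incompressible essential CRSFs. -/
def incMeasure (n m : ℕ) : Measure (SimpleGraph (WiredVertex n m)) :=
  ProbabilityTheory.uniformOn (incompressibleCRSFs n m)

/-- The probability generating function `𝔼[X ^ (number of loops)]`. -/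
def loopPGF (n m : ℕ) (X : ℂ) : ℂ := ∫ H, X ^ numLoops H ∂(incMeasure n m)

/-- The `j`-th factor `(q^j + q^(-j) - 2 + X) / (q^j + q^(-j) - 1)`, with `q = e^{πτ}`. -/
def limitFactor (τ : ℝ) (X : ℂ) (j : ℕ) : ℂ :=
  let q : ℂ := (Real.exp (Real.pi * τ) : ℂ)
  (q ^ j + (q ^ j)⁻¹ - 2 + X) / (q ^ j + (q ^ j)⁻¹ - 1)

end CylCRSF

end

noncomputable section

namespace CylCRSF

/-! ### Weighted matrices of partial maps -/

section PartialMap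

variable {V : Type*}

/-! The proof evaluates one determinant in two ways. Give the grid the flat connection `conn` that
multiplies by `ζ` for each step to the right, and let `lap` be its Laplacian, killed at the wired
vertex `none`.

Combinatorially, expanding the determinant row by row chooses for every vertex a neighbour, possibly
`none`; this is a partial map `F`. Its contribution is the product over the cycles of `F` of one
minus the holonomy (`det_mapMatrix`). Maps that run back and forth along an edge contribute zero.
The graphs of the remaining maps are exactly the essential CRSFs (`mapSubgraphs_wiredGrid`), and
summing over the maps with a given graph, that is, over the orientations of its loops, gives a
factor `2 - h - h⁻¹` for each loop of holonomy `h` (`det_lap_mapGraph`). A contractible loop has `h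
= 1` and kills the term. A simple noncontractible loop winds exactly once (`exists_winding`,
`isContractible_iff`), so `h` is `ζ ^ n` or its inverse. The determinant is therefore the sum of `X
^ N` over incompressible CRSFs, where `X = 2 - ζ ^ n - (ζ ^ n)⁻¹`; every complex `X` has this form.

Analytically, characters of the cycle times Dirichlet sines of the path diagonalise the Laplacian.
Multiplying the eigenvalues over the characters leaves one factor `2 cosh (n * rate m k) - 2 + X`
for each sine mode `k` (`sum_pow_numLoops`). Division by the value at `X = 1` gives the generating
function as a finite product.

For fixed `k`, `n * rate m k` tends to `π τ (k + 1)`, and a lower bound linear in `k`, uniform along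
the sequence, dominates the factors, so the products converge (`tendsto_loopPGF`). At `X = 0` no
limiting factor vanishes, and a nonzero limit of probabilities is positive. -/

/-- The matrix `1 - P`, where `P` is the weighted matrix of the partial map `F`. -/
def mapMatrix [DecidableEq V] (φ : V → V → ℂ) (F : V → Option V) : Matrix V V ℂ := fun v u =>
  (if u = v then 1 else 0) - (if F v = some u then φ v u else 0)

theorem mapMatrix_row_some [DecidableEq V] {φ : V → V → ℂ} {F : V → Option V} {v w : V} (h : F v = some w) :
    mapMatrix φ F v = Pi.single v 1 - φ v w • Pi.single w 1 := by
  ext u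
  simp only [mapMatrix, h, Option.some.injEq, Pi.sub_apply, Pi.single_apply, Pi.smul_apply,
    smul_eq_mul, mul_ite, mul_one, mul_zero]
  congr 1
  by_cases hu : w = u
  · subst hu; simp
  · simp [hu, Ne.symm hu]

theorem mapMatrix_row_none [DecidableEq V] {φ : V → V → ℂ} {F : V → Option V} {v : V} (h : F v = none) :
    mapMatrix φ F v = Pi.single v 1 := by
  ext u
  simp [mapMatrix, h, Pi.single_apply]

/-- Cutting a cycle of the partial map at one of its vertices. -/
theorem det_mapMatrix_cut [Fintype V] [DecidableEq V] (φ : V → V → ℂ) (F : V → Option V) (s : ℕ → V) {k : ℕ} (hk : 0 < k)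
    (hs : s k = s 0) (hF : ∀ i < k, F (s i) = some (s (i + 1)))
    (hne : ∀ i, 0 < i → i < k → s i ≠ s 0) :
    (mapMatrix φ F).det = (1 - ∏ i ∈ Finset.range k, φ (s i) (s (i + 1))) *
      (mapMatrix φ (Function.update F (s 0) none)).det := by
  -- Weight the rows along the cycle by the partial products `a i`. Row `s i` is a basis vector
  -- minus `φ` times the next one, so the weighted sum telescopes to `1 - a k` times the basis
  -- vector at `s 0`. As row `s 0` has weight one, putting this sum in its place preserves the
  -- determinant.
  set a : ℕ → ℂ := fun i => ∏ j ∈ Finset.range i, φ (s j) (s (j + 1)) with ha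
  set c : V → ℂ := fun u => ∑ i ∈ Finset.range k, if s i = u then a i else 0 with hc
  have hc0 : c (s 0) = 1 := by
    simp only [hc]
    rw [Finset.sum_eq_single 0]
    · simp [ha]
    · intro i hi hi0
      rw [if_neg (hne i (Nat.pos_of_ne_zero hi0) (Finset.mem_range.1 hi))]
    · intro h
      simp at h; omega
  have hrow : ∑ u, c u • mapMatrix φ F u = (1 - a k) • (Pi.single (s 0) 1 : V → ℂ) := by
    have h1 : ∑ u, c u • mapMatrix φ F u = ∑ i ∈ Finset.range k, a i • mapMatrix φ F (s i) := by
      simp only [hc, Finset.sum_smul]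
      rw [Finset.sum_comm]
      refine Finset.sum_congr rfl fun i _ => ?_
      simp [ite_smul]
    have h2 : ∀ i ∈ Finset.range k, a i • mapMatrix φ F (s i) =
        a i • (Pi.single (s i) 1 : V → ℂ) - a (i + 1) • (Pi.single (s (i + 1)) 1 : V → ℂ) := by
      intro i hi
      rw [mapMatrix_row_some (hF i (Finset.mem_range.1 hi)), smul_sub, smul_smul]
      simp [ha, Finset.prod_range_succ]
    rw [h1, Finset.sum_congr rfl h2,
      Finset.sum_range_sub' (fun i => a i • (Pi.single (s i) 1 : V → ℂ)) k, hs, sub_smul]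
    simp [ha]
  have h3 := Matrix.det_updateRow_sum (mapMatrix φ F) (s 0) c
  rw [hc0, one_smul] at h3
  rw [← h3]
  have h4 : (∑ u, c u • (mapMatrix φ F) u) = (1 - a k) • (Pi.single (s 0) 1 : V → ℂ) := hrow
  rw [h4, Matrix.det_updateRow_smul]
  congr 2
  ext v u
  by_cases hv : v = s 0
  · subst hv
    rw [Matrix.updateRow_self, mapMatrix_row_none (by simp)]
  · rw [Matrix.updateRow_ne hv]
    simp [mapMatrix, Function.update_of_ne hv]

/-- A partial map along which some height strictly decreases has determinant one. -/
theorem det_mapMatrix_of_height [Fintype V] [DecidableEq V]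
    (φ : V → V → ℂ) (F : V → Option V) (d : V → ℕ)
    (hd : ∀ v w, F v = some w → d w < d v) : (mapMatrix φ F).det = 1 := by
  -- Off-diagonal entries lead only to smaller height, hence the dual order; inside a block of
  -- constant height the matrix is the identity.
  have hT : (mapMatrix φ F).BlockTriangular (fun v => OrderDual.toDual (d v)) := by
    intro v u huv
    have huv' : d v < d u := huv
    have h1 : u ≠ v := by rintro rfl; exact lt_irrefl _ huv'
    have h2 : F v ≠ some u := fun h => lt_asymm huv' (hd _ _ h)
    simp [mapMatrix, h1, h2]
  rw [hT.det]
  refine Finset.prod_eq_one fun a _ => ?_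
  have h1 : (mapMatrix φ F).toSquareBlock (fun v => OrderDual.toDual (d v)) a = 1 := by
    ext ⟨v, hv⟩ ⟨u, hu⟩
    have h2 : F v ≠ some u := by
      intro h
      have h' := hd _ _ h
      have : d v = d u := OrderDual.toDual.injective (hv.trans hu.symm)
      omega
    simp [Matrix.toSquareBlock_def, mapMatrix, h2, Matrix.one_apply, eq_comm]
  rw [h1, Matrix.det_one]

/-! ### Cycles of a partial map and the product formula for the determinant -/

/-- The partial map as a self-map of `Option V` fixing `none`. -/
def optMap (F : V → Option V) (o : Option V) : Option V := o.bind F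

/-- The partial map as a total map, fixing the points where it is undefined. -/
def totMap (F : V → Option V) (v : V) : V := (F v).getD v

/-- `v` lies on a cycle of `F`. -/
def IsCyc (F : V → Option V) (v : V) : Prop := ∃ k, 0 < k ∧ (optMap F)^[k] (some v) = some v

/-- The length of the cycle through `v`. -/
def cycLen (F : V → Option V) (v : V) : ℕ := Function.minimalPeriod (optMap F) (some v)

theorem optMap_iterate_none (F : V → Option V) (i : ℕ) : (optMap F)^[i] none = none :=
  Function.iterate_fixed rfl i

/-- `none` is absorbing: an orbit that reaches it at time `i` is still there at the later time `k *
i`, when a periodic point is back at its start. -/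
theorem IsCyc.iterate_ne_none {F : V → Option V} {v : V} (h : IsCyc F v) (i : ℕ) :
    (optMap F)^[i] (some v) ≠ none := by
  obtain ⟨k, hk, hv⟩ := h
  intro hi
  have h1 : (optMap F)^[k * i] (some v) = some v := by
    have : Function.IsPeriodicPt (optMap F) k (some v) := hv
    exact this.mul_const i
  have h2 : k * i = (k * i - i) + i := by
    have : i ≤ k * i := Nat.le_mul_of_pos_left i hk
    omega
  rw [h2, Function.iterate_add_apply, hi, optMap_iterate_none] at h1
  exact Option.some_ne_none v h1.symm

theorem iterate_optMap_of_ne_none {F : V → Option V} {v : V}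
    (h : ∀ i, (optMap F)^[i] (some v) ≠ none) (i : ℕ) :
    (optMap F)^[i] (some v) = some ((totMap F)^[i] v) := by
  induction i with
  | zero => rfl
  | succ i ih =>
    have h1 := h (i + 1)
    rw [Function.iterate_succ_apply', ih] at h1 ⊢
    rw [Function.iterate_succ_apply']
    simp only [optMap, Option.bind_some, totMap] at h1 ⊢
    obtain ⟨w, hw⟩ := Option.ne_none_iff_exists'.1 h1
    rw [hw]; rfl

theorem IsCyc.iterate {F : V → Option V} {v : V} (h : IsCyc F v) (i : ℕ) :
    (optMap F)^[i] (some v) = some ((totMap F)^[i] v) :=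
  iterate_optMap_of_ne_none h.iterate_ne_none i

theorem IsCyc.map_iterate {F : V → Option V} {v : V} (h : IsCyc F v) (i : ℕ) :
    F ((totMap F)^[i] v) = some ((totMap F)^[i + 1] v) := by
  have h1 := h.iterate (i + 1)
  rw [Function.iterate_succ_apply', h.iterate i] at h1
  exact h1

theorem IsCyc.map_eq {F : V → Option V} {v : V} (h : IsCyc F v) : F v = some (totMap F v) :=
  h.map_iterate 0

theorem IsCyc.cycLen_pos {F : V → Option V} {v : V} (h : IsCyc F v) : 0 < cycLen F v :=
  Function.minimalPeriod_pos_of_mem_periodicPts h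

theorem IsCyc.iterate_cycLen {F : V → Option V} {v : V} (h : IsCyc F v) :
    (totMap F)^[cycLen F v] v = v := by
  have h1 : (optMap F)^[cycLen F v] (some v) = some v := Function.iterate_minimalPeriod
  rw [h.iterate] at h1
  exact Option.some_injective _ h1

theorem IsCyc.iterate_ne {F : V → Option V} {v : V} (h : IsCyc F v) {i : ℕ} (hi : 0 < i)
    (hik : i < cycLen F v) : (totMap F)^[i] v ≠ v := by
  intro hv
  have h1 : (optMap F)^[i] (some v) = some v := by rw [h.iterate, hv]
  exact absurd (Function.IsPeriodicPt.minimalPeriod_le hi h1) (not_le.2 hik)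

theorem IsCyc.iterate_injOn {F : V → Option V} {v : V} (h : IsCyc F v) {i j : ℕ}
    (hi : i < cycLen F v) (hj : j < cycLen F v) (hij : (totMap F)^[i] v = (totMap F)^[j] v) :
    i = j := by
  have h1 : (optMap F)^[i] (some v) = (optMap F)^[j] (some v) := by
    rw [h.iterate, h.iterate, hij]
  exact Function.iterate_injOn_Iio_minimalPeriod hi hj h1

theorem IsCyc.iterate_mod {F : V → Option V} {v : V} (h : IsCyc F v) (i : ℕ) :
    (totMap F)^[i % cycLen F v] v = (totMap F)^[i] v :=
  Function.IsPeriodicPt.iterate_mod_apply (f := totMap F) h.iterate_cycLen i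

theorem IsCyc.isCyc_iterate {F : V → Option V} {v : V} (h : IsCyc F v) (i : ℕ) :
    IsCyc F ((totMap F)^[i] v) := by
  obtain ⟨k, hk, hv⟩ := id h
  refine ⟨k, hk, ?_⟩
  rw [← h.iterate, ← Function.iterate_add_apply, add_comm, Function.iterate_add_apply, hv]

theorem IsCyc.exists_iterate_back {F : V → Option V} {v : V} (h : IsCyc F v) (i : ℕ) :
    ∃ j, (totMap F)^[j] ((totMap F)^[i] v) = v := by
  refine ⟨cycLen F v * i - i, ?_⟩
  have : i ≤ cycLen F v * i := Nat.le_mul_of_pos_left i h.cycLen_pos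
  rw [← Function.iterate_add_apply, Nat.sub_add_cancel this]
  exact Function.IsPeriodicPt.mul_const (f := totMap F) h.iterate_cycLen i

theorem IsCyc.cycLen_iterate {F : V → Option V} {v : V} (h : IsCyc F v) (i : ℕ) :
    cycLen F ((totMap F)^[i] v) = cycLen F v := by
  unfold cycLen
  rw [← h.iterate]
  exact Function.minimalPeriod_apply_iterate (f := optMap F) h i

/-- In a finite type an orbit that never leaves the domain ends up in a cycle. -/
theorem exists_isCyc_iterate [Finite V] {F : V → Option V} {v : V}
    (h : ∀ i, (optMap F)^[i] (some v) ≠ none) : ∃ i, IsCyc F ((totMap F)^[i] v) := by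
  obtain ⟨i, j, hij, he⟩ :=
    Finite.exists_ne_map_eq_of_infinite (fun i : ℕ => (optMap F)^[i] (some v))
  wlog hlt : i < j generalizing i j
  · exact this j i hij.symm he.symm (lt_of_le_of_ne (not_lt.1 hlt) hij.symm)
  refine ⟨i, j - i, by omega, ?_⟩
  rw [← iterate_optMap_of_ne_none h, ← Function.iterate_add_apply, Nat.sub_add_cancel hlt.le]
  exact he.symm

/-- A choice of one vertex on every cycle. -/
def cycReps [Fintype V] (F : V → Option V) : Finset V := by
  classical
  exact Finset.univ.filter fun v =>
    -- The vertex of least index on its cycle, for an arbitrary enumeration of `V`.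
    IsCyc F v ∧ ∀ i, Fintype.equivFin V v ≤ Fintype.equivFin V ((totMap F)^[i] v)

theorem mem_cycReps [Fintype V] {F : V → Option V} {v : V} : v ∈ cycReps F ↔
    IsCyc F v ∧ ∀ i, Fintype.equivFin V v ≤ Fintype.equivFin V ((totMap F)^[i] v) := by
  simp [cycReps]

theorem IsCyc.exists_mem_cycReps [Fintype V] {F : V → Option V} {v : V} (h : IsCyc F v) :
    ∃ i, (totMap F)^[i] v ∈ cycReps F := by
  obtain ⟨w, ⟨i, rfl⟩, hw⟩ := Set.exists_min_image (Set.range fun i => (totMap F)^[i] v)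
    (Fintype.equivFin V) (Set.toFinite _) (Set.range_nonempty _)
  refine ⟨i, mem_cycReps.2 ⟨h.isCyc_iterate i, fun j => hw _ ⟨j + i, ?_⟩⟩⟩
  simp [Function.iterate_add_apply]

theorem eq_of_mem_cycReps [Fintype V] {F : V → Option V} {v w : V} (hv : v ∈ cycReps F)
    (hw : w ∈ cycReps F) {i j : ℕ} (h : (totMap F)^[i] v = (totMap F)^[j] w) : v = w := by
  rw [mem_cycReps] at hv hw
  have key : ∀ {a b : V} {i j : ℕ}, IsCyc F a → (totMap F)^[i] a = (totMap F)^[j] b →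
      ∃ l, (totMap F)^[l] b = a := by
    intro a b i j ha hab
    obtain ⟨l, hl⟩ := ha.exists_iterate_back i
    exact ⟨l + j, by rw [Function.iterate_add_apply, ← hab, hl]⟩
  obtain ⟨a, ha⟩ := key hv.1 h
  obtain ⟨b, hb⟩ := key hw.1 h.symm
  have h1 := hv.2 b
  have h2 := hw.2 a
  rw [hb] at h1
  rw [ha] at h2
  exact (Fintype.equivFin V).injective (le_antisymm h1 h2)

/-- The product of the weights along the cycle through `v`. -/
def holonomy (φ : V → V → ℂ) (F : V → Option V) (v : V) : ℂ :=
  ∏ i ∈ Finset.range (cycLen F v), φ ((totMap F)^[i] v) ((totMap F)^[i + 1] v)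

/-- The partial map made undefined on `S`. -/
def cutMap [DecidableEq V] (F : V → Option V) (S : Finset V) (v : V) : Option V :=
  if v ∈ S then none else F v

/-- The cycles are cut one at a time. Distinct representatives lie on disjoint cycles, so the
earlier cuts leave the cycle through the next representative intact. -/
theorem det_mapMatrix_cutMap [Fintype V] [DecidableEq V] (φ : V → V → ℂ) (F : V → Option V)
    (S : Finset V) (hS : S ⊆ cycReps F) :
    (mapMatrix φ F).det = (∏ v ∈ S, (1 - holonomy φ F v)) * (mapMatrix φ (cutMap F S)).det := by
  induction S using Finset.induction_on with
  | empty =>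
    have : cutMap F ∅ = F := by ext1 v; simp [cutMap]
    simp [this]
  | insert a S ha ih =>
    have haR : a ∈ cycReps F := hS (Finset.mem_insert_self a S)
    have hSR : S ⊆ cycReps F := (Finset.subset_insert a S).trans hS
    have hcyc : IsCyc F a := (mem_cycReps.1 haR).1
    have h1 := det_mapMatrix_cut φ (cutMap F S) (fun i => (totMap F)^[i] a) hcyc.cycLen_pos
      hcyc.iterate_cycLen (fun i _ => by
        have : (totMap F)^[i] a ∉ S := fun hmem =>
          ha (eq_of_mem_cycReps (i := i) (j := 0) haR (hSR hmem) rfl ▸ hmem)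
        simp only [cutMap, if_neg this]
        exact hcyc.map_iterate i) (fun i hi hik => hcyc.iterate_ne hi hik)
    have h2 : Function.update (cutMap F S) ((totMap F)^[0] a) none = cutMap F (insert a S) := by
      ext1 v
      by_cases hv : v = a
      · subst hv; simp [cutMap]
      · simp [cutMap, hv]
    rw [ih hSR, h1, h2, Finset.prod_insert ha]
    unfold holonomy
    ring

/-- The determinant is the product over the cycles of one minus the holonomy. -/
theorem det_mapMatrix [Fintype V] [DecidableEq V] (φ : V → V → ℂ) (F : V → Option V) :
    (mapMatrix φ F).det = ∏ v ∈ cycReps F, (1 - holonomy φ F v) := by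
  rw [det_mapMatrix_cutMap φ F (cycReps F) subset_rfl]
  set G := cutMap F (cycReps F) with hG
  have hGF : ∀ {v w}, G v = some w → v ∉ cycReps F ∧ F v = some w := by
    intro v w h
    simp only [hG, cutMap] at h
    split_ifs at h with h'
    exact ⟨h', h⟩
  -- A cycle of `G` would be a cycle of `F`, and would contain a representative, where `G` is
  -- undefined.
  have hnocyc : ∀ v, ¬ IsCyc G v := by
    intro v hv
    have hit : ∀ i, (totMap F)^[i] v = (totMap G)^[i] v := by
      intro i
      induction i with
      | zero => rfl
      | succ i ih =>
        have h1 := (hGF (hv.map_iterate i)).2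
        rw [Function.iterate_succ_apply', ih]
        simp [totMap, h1]
    have hvF : IsCyc F v := by
      refine ⟨cycLen G v, hv.cycLen_pos, ?_⟩
      have h2 : ∀ i, (optMap F)^[i] (some v) = some ((totMap G)^[i] v) := by
        intro i
        induction i with
        | zero => rfl
        | succ i ih =>
          rw [Function.iterate_succ_apply', ih]
          exact (hGF (hv.map_iterate i)).2
      rw [h2, hv.iterate_cycLen]
    obtain ⟨i, hi⟩ := hvF.exists_mem_cycReps
    rw [hit] at hi
    exact (hGF (hv.map_iterate i)).1 hi
  have hex : ∀ v, ∃ i, (optMap G)^[i] (some v) = none := by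
    intro v
    by_contra! h
    obtain ⟨i, hi⟩ := exists_isCyc_iterate h
    exact hnocyc _ hi
  classical
  -- The height is the time at which the orbit under `G` first becomes `none`.
  rw [det_mapMatrix_of_height φ G (fun v => Nat.find (hex v)), mul_one]
  intro v w hvw
  have h1 := Nat.find_spec (hex v)
  obtain ⟨j, hj⟩ : ∃ j, Nat.find (hex v) = j + 1 := by
    refine Nat.exists_eq_succ_of_ne_zero fun h0 => ?_
    rw [h0] at h1
    exact Option.some_ne_none v h1
  rw [hj, Function.iterate_succ_apply] at h1
  have h2 : optMap G (some v) = some w := hvw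
  rw [h2] at h1
  rw [hj]
  exact Nat.lt_succ_of_le (Nat.find_min' (hex w) h1)

end PartialMap

/-! ### The graph of a partial map and the bundle Laplacian -/

section Laplacian

variable {V : Type*}

/-- The partial map never traverses an edge in both directions. -/
def NoTwoCycle (F : V → Option V) : Prop := ∀ v u, F v = some u → F u ≠ some v

theorem NoTwoCycle.ne {F : V → Option V} (h : NoTwoCycle F) (v : V) : F v ≠ some v :=
  fun hv => h v v hv hv

/-- The graph on `Option V` with the edges from `v` to `F v`. -/
def mapGraph (F : V → Option V) : SimpleGraph (Option V) :=
  SimpleGraph.fromRel fun a b => ∃ v, a = some v ∧ F v = b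

theorem mapGraph_adj {F : V → Option V} (hF : NoTwoCycle F) {a b : Option V} :
    (mapGraph F).Adj a b ↔ (∃ v, a = some v ∧ F v = b) ∨ ∃ v, b = some v ∧ F v = a := by
  simp only [mapGraph, SimpleGraph.fromRel_adj, and_iff_right_iff_imp]
  rintro (⟨v, rfl, rfl⟩ | ⟨v, rfl, rfl⟩) h
  · exact hF.ne v h.symm
  · exact hF.ne v h

theorem mapGraph_adj_self {F : V → Option V} (hF : NoTwoCycle F) (v : V) :
    (mapGraph F).Adj (some v) (F v) :=
  (mapGraph_adj hF).2 (Or.inl ⟨v, rfl, rfl⟩)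

theorem mapGraph_adj_some {F : V → Option V} (hF : NoTwoCycle F) {v u : V} :
    (mapGraph F).Adj (some v) (some u) ↔ F v = some u ∨ F u = some v := by
  rw [mapGraph_adj hF]
  simp

theorem mapGraph_le_iff {F : V → Option V} (hF : NoTwoCycle F) {G : SimpleGraph (Option V)} :
    mapGraph F ≤ G ↔ ∀ v, G.Adj (some v) (F v) := by
  refine ⟨fun h v => h (mapGraph_adj_self hF v), fun h a b hab => ?_⟩
  rcases (mapGraph_adj hF).1 hab with ⟨v, rfl, rfl⟩ | ⟨v, rfl, rfl⟩
  · exact h v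
  · exact (h v).symm

theorem edgeSet_mapGraph {F : V → Option V} (hF : NoTwoCycle F) :
    (mapGraph F).edgeSet = Set.range fun v => s(some v, F v) := by
  ext e
  induction e using Sym2.ind with
  | _ a b =>
    rw [SimpleGraph.mem_edgeSet, mapGraph_adj hF, Set.mem_range]
    constructor
    · rintro (⟨v, rfl, rfl⟩ | ⟨v, rfl, rfl⟩)
      · exact ⟨v, rfl⟩
      · exact ⟨v, Sym2.eq_swap⟩
    · rintro ⟨v, hv⟩
      rcases Sym2.eq_iff.1 hv with ⟨h1, h2⟩ | ⟨h1, h2⟩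
      · exact Or.inl ⟨v, h1.symm, h2⟩
      · exact Or.inr ⟨v, h1.symm, h2⟩

theorem NoTwoCycle.edge_injective {F : V → Option V} (hF : NoTwoCycle F) :
    Function.Injective fun v => s(some v, F v) := by
  intro v w h
  rcases Sym2.eq_iff.1 h with ⟨h1, _⟩ | ⟨h1, h2⟩
  · exact Option.some_injective _ h1
  · exact absurd h2 (hF w v h1.symm)

theorem ncard_edgeSet_mapGraph {F : V → Option V} (hF : NoTwoCycle F) :
    (mapGraph F).edgeSet.ncard = Nat.card V := by
  rw [edgeSet_mapGraph hF, ← Set.image_univ, Set.ncard_image_of_injective _ hF.edge_injective,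
    Set.ncard_univ]

/-- Without two-cycles distinct vertices give distinct edges, so both graphs have exactly as many
edges as `V` has elements. This makes the maps inside a given such graph the same as the maps with
that graph. -/
theorem mapGraph_eq_of_le [Finite V] {F F' : V → Option V} (hF : NoTwoCycle F)
    (hF' : NoTwoCycle F') (h : mapGraph F ≤ mapGraph F') : mapGraph F = mapGraph F' := by
  apply SimpleGraph.edgeSet_injective
  refine Set.eq_of_subset_of_ncard_le (SimpleGraph.edgeSet_mono h) ?_ (Set.toFinite _)
  rw [ncard_edgeSet_mapGraph hF, ncard_edgeSet_mapGraph hF']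

/-- The neighbours of `v` in a graph on `Option V`. -/
def nbrs [Fintype V] (G : SimpleGraph (Option V)) (v : V) : Finset (Option V) := by
  classical
  exact Finset.univ.filter (G.Adj (some v))

theorem mem_nbrs [Fintype V] {G : SimpleGraph (Option V)} {v : V} {o : Option V} :
    o ∈ nbrs G v ↔ G.Adj (some v) o := by
  simp [nbrs]

/-- The Laplacian with Dirichlet condition at `none` and parallel transport `φ`. -/
def lap [Fintype V] [DecidableEq V] (φ : V → V → ℂ) (G : SimpleGraph (Option V)) :
    Matrix V V ℂ := fun v u =>
  (if u = v then ((nbrs G v).card : ℂ) else 0) - (if some u ∈ nbrs G v then φ v u else 0)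

/-- Row `v` of the Laplacian is the sum, over the neighbours of `v`, of the corresponding possible
rows of `mapMatrix`; the determinant is multilinear in the rows. -/
theorem det_lap_eq_sum [Fintype V] [DecidableEq V] (φ : V → V → ℂ)
    (G : SimpleGraph (Option V)) :
    (lap φ G).det = ∑ F ∈ Fintype.piFinset (nbrs G), (mapMatrix φ F).det := by
  have h := (Matrix.detRowAlternating (R := ℂ) (n := V)).toMultilinearMap.map_sum_finset
    (fun v (o : Option V) (u : V) =>
      (if u = v then (1 : ℂ) else 0) - (if o = some u then φ v u else 0)) (nbrs G)
  refine Eq.trans ?_ h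
  change _ = Matrix.det _
  congr 1
  ext v u
  simp only [lap, Finset.sum_apply, Finset.sum_sub_distrib, Finset.sum_const, nsmul_eq_mul,
    mul_ite, mul_one, mul_zero, Finset.sum_ite_eq']

/-- Going along an edge and back has holonomy one, so the factor of this two-cycle vanishes. -/
theorem det_mapMatrix_eq_zero [Fintype V] [DecidableEq V] {φ : V → V → ℂ} {F : V → Option V}
    {v u : V} (hvu : v ≠ u) (h1 : F v = some u) (h2 : F u = some v) (hφ : φ v u * φ u v = 1) :
    (mapMatrix φ F).det = 0 := by
  have h := det_mapMatrix_cut φ F (fun i => if i % 2 = 0 then v else u) (k := 2) (by norm_num)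
    (by simp) (by
      intro i hi
      interval_cases i <;> simp [h1, h2]) (by
      intro i hi hi'
      interval_cases i
      simpa using hvu.symm)
  rw [h, Finset.prod_range_succ, Finset.prod_range_one]
  simp [hφ]

/-- The Laplacian factors through the incidence matrix of vertices and edges. Here each edge is
indexed by its tail, which makes the incidence matrix square and equal to `mapMatrix`; the other
factor is its transpose with reversed transport. The determinant is thus a product of two known
ones. -/
theorem lap_mapGraph [Fintype V] [DecidableEq V] {φ : V → V → ℂ} {F : V → Option V}
    (hF : NoTwoCycle F) (hφ : ∀ v u, F v = some u → φ v u * φ u v = 1) :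
    lap φ (mapGraph F) = (mapMatrix (fun a b => φ b a) F).transpose * mapMatrix φ F := by
  have hcard : ∀ v, ((nbrs (mapGraph F) v).card : ℂ) =
      1 + ∑ w, (if F w = some v then (1 : ℂ) else 0) := by
    intro v
    have h1 : nbrs (mapGraph F) v =
        insert (F v) ((Finset.univ.filter fun w => F w = some v).map Function.Embedding.some) := by
      ext o
      rw [mem_nbrs, mapGraph_adj hF]
      simp only [Option.some.injEq, exists_eq_left', Finset.mem_insert, Finset.mem_map,
        Finset.mem_filter, Finset.mem_univ, true_and, Function.Embedding.some_apply]
      constructor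
      · rintro (h | ⟨w, h1, h2⟩)
        · exact Or.inl h.symm
        · exact Or.inr ⟨w, h2, h1.symm⟩
      · rintro (h | ⟨w, h1, h2⟩)
        · exact Or.inl h.symm
        · exact Or.inr ⟨w, h2.symm, h1⟩
    rw [h1, Finset.card_insert_of_notMem, Finset.card_map]
    · simp [add_comm]
    · simp only [Finset.mem_map, Finset.mem_filter, Finset.mem_univ, true_and,
        Function.Embedding.some_apply, not_exists, not_and]
      intro w hw h
      exact hF w v hw h.symm
  ext v u
  have hsum : ∑ w, (if F w = some v then φ v w else 0) * (if F w = some u then φ w u else 0) =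
      if u = v then ∑ w, (if F w = some v then (1 : ℂ) else 0) else 0 := by
    split_ifs with huv
    · subst huv
      refine Finset.sum_congr rfl fun w _ => ?_
      split_ifs with h
      · rw [mul_comm, hφ w u h]
      · simp
    · refine Finset.sum_eq_zero fun w _ => ?_
      by_cases h1 : F w = some v
      · have h2 : F w ≠ some u := by
          rw [h1]
          exact fun h => huv (Option.some_injective _ h).symm
        simp [h2]
      · simp [h1]
  have hadj : (if some u ∈ nbrs (mapGraph F) v then φ v u else 0) =
      (if F v = some u then φ v u else 0) + (if F u = some v then φ v u else 0) := by
    simp only [mem_nbrs, mapGraph_adj_some hF]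
    by_cases h1 : F v = some u
    · simp [h1, hF v u h1]
    · simp [h1]
  have h1 : ∑ w, (if v = w then (1 : ℂ) else 0) * (if u = w then 1 else 0) =
      if u = v then 1 else 0 := by simp [eq_comm]
  have h2 : ∑ w, (if v = w then (1 : ℂ) else 0) * (if F w = some u then φ w u else 0) =
      if F v = some u then φ v u else 0 := by
    simp only [ite_mul, one_mul, zero_mul, Finset.sum_ite_eq, Finset.mem_univ, if_true]
  have h3 : ∑ w, (if F w = some v then φ v w else 0) * (if u = w then (1 : ℂ) else 0) =
      if F u = some v then φ v u else 0 := by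
    simp only [mul_ite, mul_one, mul_zero, Finset.sum_ite_eq, Finset.mem_univ, if_true]
  simp only [lap, Matrix.mul_apply, Matrix.transpose_apply, mapMatrix, sub_mul, mul_sub,
    Finset.sum_sub_distrib, hsum, h1, h2, h3]
  rw [hcard v, hadj]
  split_ifs <;> ring

theorem holonomy_transpose_mul {φ : V → V → ℂ} {F : V → Option V}
    (hφ : ∀ v u, F v = some u → φ v u * φ u v = 1) {v : V} (hv : IsCyc F v) :
    holonomy (fun a b => φ b a) F v * holonomy φ F v = 1 := by
  unfold holonomy
  rw [← Finset.prod_mul_distrib]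
  refine Finset.prod_eq_one fun i _ => ?_
  rw [mul_comm]
  exact hφ _ _ (hv.map_iterate i)

theorem det_lap_mapGraph [Fintype V] [DecidableEq V] {φ : V → V → ℂ} {F : V → Option V}
    (hF : NoTwoCycle F) (hφ : ∀ v u, F v = some u → φ v u * φ u v = 1) :
    (lap φ (mapGraph F)).det =
      ∏ v ∈ cycReps F, (2 - holonomy φ F v - (holonomy φ F v)⁻¹) := by
  rw [lap_mapGraph hF hφ, Matrix.det_mul, Matrix.det_transpose, det_mapMatrix, det_mapMatrix,
    ← Finset.prod_mul_distrib]
  refine Finset.prod_congr rfl fun v hv => ?_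
  have h := holonomy_transpose_mul hφ (mem_cycReps.1 hv).1
  rw [← eq_inv_of_mul_eq_one_left h]
  linear_combination h

/-- The subgraphs of `G` that are graphs of partial maps. -/
def mapSubgraphs (G : SimpleGraph (Option V)) : Set (SimpleGraph (Option V)) :=
  {H | ∃ F : V → Option V, NoTwoCycle F ∧ mapGraph F = H ∧ H ≤ G}

/-- The determinant of the bundle Laplacian is the sum of those of the subgraphs with as many
edges as vertices. -/
theorem det_lap_eq_sum_mapSubgraphs [Fintype V] [DecidableEq V] {φ : V → V → ℂ}
    {G : SimpleGraph (Option V)} (hφ : ∀ v u, G.Adj (some v) (some u) → φ v u * φ u v = 1) :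
    (lap φ G).det = ∑ H ∈ (Set.toFinite (mapSubgraphs G)).toFinset, (lap φ H).det := by
  classical
  -- Only maps without two-cycles survive in the row expansion. Applied to `G` and to each `H`, this
  -- identifies the part of the first sum with `mapGraph F = H` with the whole sum for `H`.
  have hvan : ∀ {G' : SimpleGraph (Option V)}, G' ≤ G → (lap φ G').det =
      ∑ F ∈ (Fintype.piFinset (nbrs G')).filter NoTwoCycle, (mapMatrix φ F).det := by
    intro G' hG'
    rw [det_lap_eq_sum, Finset.sum_filter]
    refine Finset.sum_congr rfl fun F hFm => ?_
    split_ifs with hF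
    · rfl
    · simp only [NoTwoCycle, not_forall, not_not] at hF
      obtain ⟨v, u, h1, h2⟩ := hF
      have hadj : G'.Adj (some v) (some u) := by
        rw [← h1]; exact mem_nbrs.1 (Fintype.mem_piFinset.1 hFm v)
      exact det_mapMatrix_eq_zero (fun h => hadj.ne (congrArg some h)) h1 h2
        (hφ v u (hG' hadj))
  have hmem : ∀ {G' : SimpleGraph (Option V)} {F : V → Option V},
      F ∈ (Fintype.piFinset (nbrs G')).filter NoTwoCycle ↔ NoTwoCycle F ∧ mapGraph F ≤ G' := by
    intro G' F
    rw [Finset.mem_filter, Fintype.mem_piFinset, and_comm]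
    refine and_congr_right fun hF => ?_
    simp only [mem_nbrs, mapGraph_le_iff hF]
  rw [hvan le_rfl, ← Finset.sum_fiberwise_of_maps_to (g := mapGraph)
    (t := (Set.toFinite (mapSubgraphs G)).toFinset)]
  · refine Finset.sum_congr rfl fun H hH => ?_
    obtain ⟨F₀, hF₀, rfl, hle⟩ := (Set.Finite.mem_toFinset _).1 hH
    rw [hvan hle]
    refine Finset.sum_congr ?_ fun _ _ => rfl
    ext F
    rw [Finset.mem_filter, hmem, hmem]
    constructor
    · rintro ⟨⟨h1, _⟩, h3⟩
      exact ⟨h1, h3.le⟩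
    · rintro ⟨h1, h2⟩
      have h3 := mapGraph_eq_of_le h1 hF₀ h2
      exact ⟨⟨h1, h3.le.trans hle⟩, h3⟩
  · intro F hF
    obtain ⟨h1, h2⟩ := hmem.1 hF
    exact (Set.Finite.mem_toFinset _).2 ⟨F, h1, rfl, h2⟩

end Laplacian

/-! ### Cycles of the graph of a partial map -/

section Cycles

variable {V : Type*}

/-- The edges of the cycle of `F` through `x`. -/
def cycEdges (F : V → Option V) (x : V) : Set (Sym2 (Option V)) :=
  {e | ∃ i, e = s(some ((totMap F)^[i] x), some ((totMap F)^[i + 1] x))}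

/-- A closed sequence that follows the partial map. -/
theorem isCyc_of_forward {F : V → Option V} {s : ℕ → Option V} {k : ℕ} (hk : 0 < k)
    (h0 : s k = s 0) (hinj : ∀ i < k, ∀ j < k, s i = s j → i = j)
    (hfw : ∀ i < k, ∃ v, s i = some v ∧ F v = s (i + 1)) :
    ∃ x, s 0 = some x ∧ IsCyc F x ∧ cycLen F x = k ∧
      ∀ i ≤ k, s i = some ((totMap F)^[i] x) := by
  obtain ⟨x, hx, -⟩ := hfw 0 hk
  have hit : ∀ i ≤ k, (optMap F)^[i] (some x) = s i := by
    intro i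
    induction i with
    | zero => intro _; exact hx.symm
    | succ i ih =>
      intro hi
      obtain ⟨v, hv, hv'⟩ := hfw i (by omega)
      rw [Function.iterate_succ_apply', ih (by omega), hv, ← hv']
      rfl
  have hper : (optMap F)^[k] (some x) = some x := by rw [hit k le_rfl, h0, hx]
  have hcyc : IsCyc F x := ⟨k, hk, hper⟩
  refine ⟨x, hx, hcyc, ?_, fun i hi => by rw [← hit i hi, hcyc.iterate]⟩
  have hle : cycLen F x ≤ k := Function.IsPeriodicPt.minimalPeriod_le hk hper
  by_contra hne
  have h1 : s (cycLen F x) = s 0 := by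
    rw [← hit _ hle, hx]
    exact Function.iterate_minimalPeriod
  have := hinj _ (lt_of_le_of_ne hle hne) 0 hk h1
  exact hcyc.cycLen_pos.ne' this

/-- A cycle in the graph of a partial map follows the map in one of its two directions. -/
theorem isCyc_of_closed_sequence {F : V → Option V} {s : ℕ → Option V} {k : ℕ}
    (hk : 3 ≤ k) (h0 : s k = s 0) (hinj : ∀ i < k, ∀ j < k, s i = s j → i = j)
    (hadj : ∀ i < k, (∃ v, s i = some v ∧ F v = s (i + 1)) ∨
      ∃ v, s (i + 1) = some v ∧ F v = s i) :
    ∃ x, s 0 = some x ∧ IsCyc F x ∧ cycLen F x = k ∧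
      ((∀ i ≤ k, s i = some ((totMap F)^[i] x)) ∨
        ∀ i ≤ k, s (k - i) = some ((totMap F)^[i] x)) := by
  -- A vertex has only one outgoing arrow. If it points forward, the preceding edge must be an arrow
  -- out of its other endpoint; otherwise two neighbours of the vertex on the cycle would coincide,
  -- impossible for length at least three.
  have hstep : ∀ i, i + 1 < k → (∃ v, s (i + 1) = some v ∧ F v = s (i + 2)) →
      ∃ v, s i = some v ∧ F v = s (i + 1) := by
    rintro i hi ⟨v, hv, hv'⟩
    refine (hadj i (by omega)).resolve_right ?_
    rintro ⟨w, hw, hw'⟩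
    obtain rfl : v = w := Option.some_injective _ (hv.symm.trans hw)
    have h1 : s i = s (i + 2) := hw'.symm.trans hv'
    rcases Nat.lt_or_ge (i + 2) k with h | h
    · exact absurd (hinj i (by omega) _ h h1) (by omega)
    · obtain rfl : k = i + 2 := by omega
      exact absurd (hinj i (by omega) 0 (by omega) (h1.trans h0)) (by omega)
  have hwrap : (∃ v, s 0 = some v ∧ F v = s 1) → ∃ v, s (k - 1) = some v ∧ F v = s k := by
    rintro ⟨v, hv, hv'⟩
    have hk1 : k - 1 + 1 = k := by omega
    have h := hadj (k - 1) (by omega)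
    rw [hk1] at h
    refine h.resolve_right ?_
    rintro ⟨w, hw, hw'⟩
    obtain rfl : v = w := Option.some_injective _ (hv.symm.trans (h0.symm.trans hw))
    exact absurd (hinj _ (by omega) 1 (by omega) (hw'.symm.trans hv')) (by omega)
  have hdown : ∀ i j, i ≤ j → j < k → (∃ v, s j = some v ∧ F v = s (j + 1)) →
      ∃ v, s i = some v ∧ F v = s (i + 1) := by
    intro i j hij
    induction j, hij using Nat.le_induction with
    | base => exact fun _ h => h
    | succ j hij ih => exact fun hj h => ih (by omega) (hstep j (by omega) h)
  by_cases hex : ∃ i < k, ∃ v, s i = some v ∧ F v = s (i + 1)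
  · obtain ⟨i, hi, h⟩ := hex
    have h1 := hwrap (hdown 0 i (by omega) hi h)
    have hfw : ∀ i < k, ∃ v, s i = some v ∧ F v = s (i + 1) := fun i hi =>
      hdown i (k - 1) (by omega) (by omega) (by rwa [Nat.sub_add_cancel (by omega : 1 ≤ k)])
    obtain ⟨x, h1, h2, h3, h4⟩ := isCyc_of_forward (by omega) h0 hinj hfw
    exact ⟨x, h1, h2, h3, Or.inl h4⟩
  · have hbw : ∀ i < k, ∃ v, s (i + 1) = some v ∧ F v = s i := fun i hi =>
      (hadj i hi).resolve_left fun h => hex ⟨i, hi, h⟩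
    -- No arrow points forward, so the reversed sequence follows `F`.
    obtain ⟨x, h1, h2, h3, h4⟩ := isCyc_of_forward (F := F) (s := fun i => s (k - i))
      (k := k) (by omega) (by simp [h0]) (by
        intro i hi j hj hij
        rcases Nat.eq_zero_or_pos i with rfl | hi0 <;> rcases Nat.eq_zero_or_pos j with rfl | hj0
        · rfl
        · simp only [Nat.sub_zero, h0] at hij
          have := hinj 0 (by omega) _ (by omega) hij
          omega
        · simp only [Nat.sub_zero, h0] at hij
          have := hinj _ (by omega) 0 (by omega) hij
          omega
        · have := hinj _ (by omega) _ (by omega) hij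
          omega) (by
        intro i hi
        have h := hbw (k - (i + 1)) (by omega)
        have hki : k - (i + 1) + 1 = k - i := by omega
        rwa [hki] at h)
    refine ⟨x, ?_, h2, h3, Or.inr h4⟩
    rw [← h0]
    simpa using h1

/-- The vertices of a cycle all of whose edges are edges of the graph of a partial map. -/
theorem isCyc_of_isCycle {F : V → Option V} (hF : NoTwoCycle F) {α : Type*}
    {K : SimpleGraph α} {e : α → Option V} (he : Function.Injective e) {v : α} {p : K.Walk v v}
    (hp : p.IsCycle)
    (hadj : ∀ i < p.length, (mapGraph F).Adj (e (p.getVert i)) (e (p.getVert (i + 1)))) :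
    ∃ x, e v = some x ∧ IsCyc F x ∧ cycLen F x = p.length ∧
      ((∀ i ≤ p.length, e (p.getVert i) = some ((totMap F)^[i] x)) ∨
        ∀ i ≤ p.length, e (p.getVert (p.length - i)) = some ((totMap F)^[i] x)) := by
  have h := isCyc_of_closed_sequence (F := F) (s := fun i => e (p.getVert i)) hp.three_le_length
    (by simp) (fun i hi j hj hij => hp.getVert_injOn' (by simp; omega) (by simp; omega) (he hij))
    (fun i hi => (mapGraph_adj hF).1 (hadj i hi))
  simpa using h

theorem edges_eq_cycEdges {F : V → Option V} (hF : NoTwoCycle F) {o : Option V}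
    {p : (mapGraph F).Walk o o} (hp : p.IsCycle) :
    ∃ x, o = some x ∧ IsCyc F x ∧ {e | e ∈ p.edges} = cycEdges F x := by
  obtain ⟨x, hx, hc, hlen, h⟩ := isCyc_of_isCycle hF Function.injective_id hp
    (fun i hi => p.adj_getVert_succ hi)
  refine ⟨x, hx, hc, ?_⟩
  ext e
  induction e using Sym2.ind with
  | _ a b =>
  rw [Set.mem_ofPred_eq, SimpleGraph.Walk.mk_mem_edges_iff_exists]
  simp only [cycEdges, Set.mem_ofPred_eq, id] at h ⊢
  have hmod : ∀ i, ∃ j < p.length, (totMap F)^[i] x = (totMap F)^[j] x ∧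
      (totMap F)^[i + 1] x = (totMap F)^[j + 1] x := by
    intro i
    refine ⟨i % p.length, Nat.mod_lt _ (hlen ▸ hc.cycLen_pos), ?_, ?_⟩
    · rw [← hlen, hc.iterate_mod]
    · rw [← hlen, Function.iterate_succ_apply', Function.iterate_succ_apply', hc.iterate_mod]
  rcases h with h | h
  · constructor
    · rintro ⟨i, hi, he⟩
      exact ⟨i, by rw [← he, h i hi.le, h (i + 1) hi]⟩
    · rintro ⟨i, he⟩
      obtain ⟨j, hj, h1, h2⟩ := hmod i
      exact ⟨j, hj, by rw [he, h j hj.le, h (j + 1) hj, h1, h2]⟩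
  · constructor
    · rintro ⟨i, hi, he⟩
      refine ⟨p.length - (i + 1), ?_⟩
      rw [← he, ← h _ (by omega), ← h _ (by omega), Sym2.eq_swap]
      congr 3 <;> omega
    · rintro ⟨i, he⟩
      obtain ⟨j, hj, h1, h2⟩ := hmod i
      refine ⟨p.length - (j + 1), by omega, ?_⟩
      rw [he, h1, h2, ← h _ hj.le, ← h _ hj, Sym2.eq_swap]
      congr 3
      omega

/-- The cycle of `F` through `x` as a graph. -/
def cycGraph (F : V → Option V) (x : V) : SimpleGraph V :=
  SimpleGraph.fromEdgeSet {e | ∃ i, e = s((totMap F)^[i] x, (totMap F)^[i + 1] x)}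

theorem IsCyc.iterate_succ_ne {F : V → Option V} (hF : NoTwoCycle F) {x : V} (hx : IsCyc F x)
    (i : ℕ) : (totMap F)^[i] x ≠ (totMap F)^[i + 1] x := by
  intro h
  have h1 := hx.map_iterate i
  rw [← h] at h1
  exact hF.ne _ h1

/-- The arrows after the first lead from `F x` back to `x`. A path among them, closed by the first
edge, is a cycle; they do not contain that edge because `F` has no two-cycle. -/
theorem exists_isCycle_cycGraph {F : V → Option V} (hF : NoTwoCycle F) {x : V}
    (hx : IsCyc F x) : ∃ p : (cycGraph F x).Walk x x, p.IsCycle := by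
  classical
  set f := totMap F with hf
  set K := SimpleGraph.fromEdgeSet
    {e | ∃ i, 1 ≤ i ∧ i < cycLen F x ∧ e = s(f^[i] x, f^[i + 1] x)} with hK
  have hKle : K ≤ cycGraph F x := by
    apply SimpleGraph.fromEdgeSet_mono
    rintro e ⟨i, -, -, rfl⟩
    exact ⟨i, rfl⟩
  have hreach : ∀ i, 1 ≤ i → i ≤ cycLen F x → K.Reachable (f^[1] x) (f^[i] x) := by
    intro i hi
    induction i, hi using Nat.le_induction with
    | base => exact fun _ => SimpleGraph.Reachable.refl _
    | succ i hi ih =>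
      intro hik
      refine (ih (by omega)).trans (SimpleGraph.Adj.reachable ?_)
      rw [hK, SimpleGraph.fromEdgeSet_adj]
      exact ⟨⟨i, hi, hik, rfl⟩, hx.iterate_succ_ne hF i⟩
  have hr := hreach _ hx.cycLen_pos le_rfl
  rw [hx.iterate_cycLen] at hr
  obtain ⟨w⟩ := hr
  set q : K.Path (f^[1] x) x := w.toPath
  have hadj : (cycGraph F x).Adj x (f^[1] x) := by
    rw [cycGraph, SimpleGraph.fromEdgeSet_adj]
    exact ⟨⟨0, rfl⟩, hx.iterate_succ_ne hF 0⟩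
  refine ⟨SimpleGraph.Walk.cons hadj ((q : K.Walk _ _).mapLe hKle),
    SimpleGraph.Path.cons_isCycle ⟨_, (SimpleGraph.Walk.isPath_mapLe hKle).2 q.2⟩ hadj ?_⟩
  intro hmem
  simp only [SimpleGraph.Walk.edges_mapLe_eq_edges] at hmem
  have h1 := SimpleGraph.Walk.edges_subset_edgeSet _ hmem
  rw [hK, SimpleGraph.edgeSet_fromEdgeSet] at h1
  obtain ⟨⟨i, hi, hik, he⟩, -⟩ := h1
  rcases Sym2.eq_iff.1 he with ⟨h2, -⟩ | ⟨h2, h3⟩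
  · exact hx.iterate_ne hi hik h2.symm
  · have h4 := hx.map_iterate i
    rw [← hf, ← h3, ← h2] at h4
    exact hF _ _ hx.map_eq h4

theorem cyclesThrough_mapGraph {F : V → Option V} (hF : NoTwoCycle F) (S : Set (Option V)) :
    cyclesThrough (mapGraph F) S = {C | ∃ x, some x ∈ S ∧ IsCyc F x ∧ C = cycEdges F x} := by
  ext C
  constructor
  · rintro ⟨o, ho, p, hp, rfl⟩
    obtain ⟨x, rfl, hc, he⟩ := edges_eq_cycEdges hF hp
    exact ⟨x, ho, hc, he⟩
  · rintro ⟨x, hx, hc, rfl⟩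
    obtain ⟨p, hp⟩ := exists_isCycle_cycGraph hF hc
    let e : cycGraph F x →g mapGraph F := ⟨some, by
      intro a b hab
      rw [cycGraph, SimpleGraph.fromEdgeSet_adj] at hab
      obtain ⟨⟨i, hi⟩, -⟩ := hab
      have h1 := mapGraph_adj_self hF ((totMap F)^[i] x)
      rw [hc.map_iterate i] at h1
      rcases Sym2.eq_iff.1 hi with ⟨rfl, rfl⟩ | ⟨rfl, rfl⟩
      · exact h1
      · exact h1.symm⟩
    have hp' : (p.map e).IsCycle :=
      (SimpleGraph.Walk.isCycle_map_iff_of_injective (Option.some_injective _)).2 hp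
    obtain ⟨y, hy, -, he⟩ := edges_eq_cycEdges hF hp'
    obtain rfl : x = y := Option.some_injective _ hy
    exact ⟨some x, hx, p.map e, hp', he.symm⟩

theorem cycEdges_iterate {F : V → Option V} {x : V} (hx : IsCyc F x) (i : ℕ) :
    cycEdges F ((totMap F)^[i] x) = cycEdges F x := by
  have key : ∀ (y : V) (j : ℕ), cycEdges F ((totMap F)^[j] y) ⊆ cycEdges F y := by
    rintro y j e ⟨l, rfl⟩
    refine ⟨l + j, ?_⟩
    rw [← Function.iterate_add_apply, ← Function.iterate_add_apply]
    rw [add_right_comm]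
  refine (key x i).antisymm ?_
  obtain ⟨j, hj⟩ := hx.exists_iterate_back i
  conv_lhs => rw [← hj]
  exact key _ j

/-- The number of loops of the graph of a partial map is the number of cycles of the map. -/
theorem numLoops_mapGraph [Fintype V] {F : V → Option V} (hF : NoTwoCycle F) :
    numLoops (mapGraph F) = (cycReps F).card := by
  have h1 : cyclesThrough (mapGraph F) Set.univ = cycEdges F '' (cycReps F : Set V) := by
    rw [cyclesThrough_mapGraph hF]
    ext C
    constructor
    · rintro ⟨x, -, hx, rfl⟩
      obtain ⟨i, hi⟩ := hx.exists_mem_cycReps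
      exact ⟨_, hi, cycEdges_iterate hx i⟩
    · rintro ⟨x, hx, rfl⟩
      exact ⟨x, Set.mem_univ _, (mem_cycReps.1 hx).1, rfl⟩
  rw [numLoops, h1, Set.InjOn.ncard_image, Set.ncard_coe_finset]
  intro x hx y hy hxy
  have h2 : s(some x, some (totMap F x)) ∈ cycEdges F y := by
    rw [← hxy]
    exact ⟨0, rfl⟩
  obtain ⟨i, hi⟩ := h2
  rcases Sym2.eq_iff.1 hi with ⟨h3, -⟩ | ⟨h3, -⟩
  · exact eq_of_mem_cycReps (i := 0) (j := i) hx hy (Option.some_injective _ h3)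
  · exact eq_of_mem_cycReps (i := 0) (j := i + 1) hx hy (Option.some_injective _ h3)

/-- Connected vertices have a common iterate. -/
theorem exists_iterate_eq_of_reachable {F : V → Option V} (hF : NoTwoCycle F) {a b : Option V}
    (h : (mapGraph F).Reachable a b) : ∃ i j, (optMap F)^[i] a = (optMap F)^[j] b := by
  obtain ⟨p⟩ := h
  induction p with
  | nil => exact ⟨0, 0, rfl⟩
  | cons hadj _ ih =>
    obtain ⟨i, j, hij⟩ := ih
    rcases (mapGraph_adj hF).1 hadj with ⟨v, rfl, rfl⟩ | ⟨v, rfl, rfl⟩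
    · exact ⟨i + 1, j, by rw [Function.iterate_succ_apply]; exact hij⟩
    · refine ⟨i, j + 1, ?_⟩
      rw [Function.iterate_succ_apply' (optMap F) j, ← hij, ← Function.iterate_succ_apply' (optMap F) i,
        Function.iterate_succ_apply]
      rfl

theorem reachable_iterate {F : V → Option V} (hF : NoTwoCycle F) (a : Option V) (i : ℕ) :
    (mapGraph F).Reachable a ((optMap F)^[i] a) := by
  induction i with
  | zero => exact SimpleGraph.Reachable.refl _
  | succ i ih =>
    refine ih.trans ?_
    rw [Function.iterate_succ_apply']
    cases (optMap F)^[i] a with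
    | none => exact SimpleGraph.Reachable.refl _
    | some v => exact (mapGraph_adj_self hF v).reachable

/-- A vertex connected to `none` has an iterate equal to `none`, which no periodic vertex has. -/
theorem cyclesThrough_mapGraph_root {F : V → Option V} (hF : NoTwoCycle F)
    {c : (mapGraph F).ConnectedComponent} (hc : c = (mapGraph F).connectedComponentMk none) :
    cyclesThrough (mapGraph F) c.supp = ∅ := by
  rw [cyclesThrough_mapGraph hF, Set.eq_empty_iff_forall_notMem]
  rintro C ⟨x, hx, hcyc, -⟩
  rw [hc, SimpleGraph.ConnectedComponent.mem_supp_iff, SimpleGraph.ConnectedComponent.eq] at hx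
  obtain ⟨i, j, hij⟩ := exists_iterate_eq_of_reachable hF hx
  rw [optMap_iterate_none] at hij
  exact hcyc.iterate_ne_none i hij

/-- An orbit that never reaches `none` enters a cycle, by finiteness. Two cycles in one component
share an iterate, hence coincide. -/
theorem cyclesThrough_mapGraph_nonroot [Finite V] {F : V → Option V} (hF : NoTwoCycle F)
    {c : (mapGraph F).ConnectedComponent} (hc : c ≠ (mapGraph F).connectedComponentMk none) :
    ∃! C, C ∈ cyclesThrough (mapGraph F) c.supp := by
  rw [cyclesThrough_mapGraph hF]
  induction c using SimpleGraph.ConnectedComponent.ind with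
  | h o =>
  have hne : ∀ i, (optMap F)^[i] o ≠ none := by
    intro i hi
    apply hc
    rw [SimpleGraph.ConnectedComponent.eq, ← hi]
    exact reachable_iterate hF o i
  obtain ⟨v, rfl⟩ := Option.ne_none_iff_exists'.1 (hne 0)
  obtain ⟨i, hi⟩ := exists_isCyc_iterate hne
  refine ⟨cycEdges F ((totMap F)^[i] v), ⟨_, ?_, hi, rfl⟩, ?_⟩
  · rw [SimpleGraph.ConnectedComponent.mem_supp_iff, SimpleGraph.ConnectedComponent.eq,
      ← iterate_optMap_of_ne_none hne]
    exact (reachable_iterate hF _ i).symm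
  · rintro C ⟨x, hx, hcyc, rfl⟩
    rw [SimpleGraph.ConnectedComponent.mem_supp_iff, SimpleGraph.ConnectedComponent.eq] at hx
    obtain ⟨a, b, hab⟩ := exists_iterate_eq_of_reachable hF
      (hx.trans (reachable_iterate hF (some v) i))
    rw [iterate_optMap_of_ne_none hne, hcyc.iterate, hi.iterate] at hab
    rw [← cycEdges_iterate hcyc a, ← cycEdges_iterate hi b, Option.some_injective _ hab]

end Cycles

/-! ### Every essential cycle-rooted spanning forest is the graph of a partial map -/

section Orientation

variable {V : Type*}

/-- Cutting the unique cycle of a component leaves a spanning tree of the component. -/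
theorem exists_cut_of_existsUnique {W : Type*} {H : SimpleGraph W} {c : H.ConnectedComponent}
    (hc : ∃! C, C ∈ cyclesThrough H c.supp) :
    ∃ a b, H.Adj a b ∧ H.connectedComponentMk a = c ∧
      cyclesThrough (H.deleteEdges {s(a, b)}) c.supp = ∅ ∧
      ∀ v ∈ c.supp, (H.deleteEdges {s(a, b)}).Reachable v a := by
  obtain ⟨C, ⟨a, ha, p, hp, rfl⟩, huniq⟩ := hc
  have hlen := hp.three_le_length
  have hadj : H.Adj a (p.getVert 1) := by
    have := p.adj_getVert_succ (i := 0) (by omega)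
    simpa using this
  have hmem : s(a, p.getVert 1) ∈ p.edges := by
    rw [SimpleGraph.Walk.mk_mem_edges_iff_exists]
    exact ⟨0, by omega, by simp⟩
  set b := p.getVert 1
  have hr : (H.deleteEdges {s(a, b)}).Reachable a b :=
    (SimpleGraph.adj_and_reachable_delete_edges_iff_exists_cycle.2 ⟨a, p, hp, hmem⟩).2
  refine ⟨a, b, hadj, ha, ?_, ?_⟩
  · rw [Set.eq_empty_iff_forall_notMem]
    rintro C ⟨v, hv, q, hq, rfl⟩
    have hle := H.deleteEdges_le {s(a, b)}
    have h1 := huniq _ ⟨v, hv, q.mapLe hle, (SimpleGraph.Walk.isCycle_mapLe hle).2 hq, rfl⟩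
    have h2 : s(a, b) ∈ (q.mapLe hle).edges := by
      have : s(a, b) ∈ {e | e ∈ (q.mapLe hle).edges} := by rw [h1]; exact hmem
      exact this
    rw [SimpleGraph.Walk.edges_mapLe_eq_edges] at h2
    have h3 := q.edges_subset_edgeSet h2
    rw [SimpleGraph.edgeSet_deleteEdges] at h3
    exact h3.2 rfl
  · intro v hv
    have h1 : H.Reachable v a := by
      rw [← SimpleGraph.ConnectedComponent.eq]
      exact hv.trans ha.symm
    obtain ⟨w⟩ := h1
    have key : ∀ {u z : W} (w : H.Walk u z), (H.deleteEdges {s(a, b)}).Reachable u z := by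
      intro u z w
      induction w with
      | nil => exact SimpleGraph.Reachable.refl _
      | @cons x y _ h _ ih =>
        refine SimpleGraph.Reachable.trans ?_ ih
        by_cases he : s(x, y) = s(a, b)
        · rcases Sym2.eq_iff.1 he with ⟨rfl, rfl⟩ | ⟨rfl, rfl⟩
          · exact hr
          · exact hr.symm
        · refine SimpleGraph.Adj.reachable ?_
          rw [SimpleGraph.deleteEdges_adj]
          exact ⟨h, by simpa using he⟩
    exact key w

theorem exists_adj_dist_lt {W : Type*} {K : SimpleGraph W} {v r : W} (h : K.Reachable v r)
    (hne : v ≠ r) : ∃ u, K.Adj v u ∧ K.dist u r < K.dist v r := by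
  obtain ⟨p, hp⟩ := h.exists_walk_length_eq_dist
  cases p with
  | nil => exact absurd rfl hne
  | @cons _ u _ hadj q =>
    refine ⟨u, hadj, ?_⟩
    have := SimpleGraph.dist_le q
    rw [SimpleGraph.Walk.length_cons] at hp
    omega

/-- Orient each component towards a root. The component of `none` is a tree rooted at `none`. In any
other component cut one edge of the cycle: the rest is a spanning tree, rooted at an end of the cut
edge, and the root itself is sent along that edge. Elsewhere `F` decreases the distance to the root.
-/
theorem exists_mapGraph_eq {H : SimpleGraph (Option V)}
    (h0 : ∀ c : H.ConnectedComponent, c = H.connectedComponentMk none →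
      cyclesThrough H c.supp = ∅)
    (h1 : ∀ c : H.ConnectedComponent, c ≠ H.connectedComponentMk none →
      ∃! C, C ∈ cyclesThrough H c.supp) :
    ∃ F : V → Option V, NoTwoCycle F ∧ mapGraph F = H := by
  classical
  have hdata : ∀ c : H.ConnectedComponent, ∃ (r : Option V) (K : SimpleGraph (Option V)),
      K ≤ H ∧ H.connectedComponentMk r = c ∧ cyclesThrough K c.supp = ∅ ∧
      (∀ v ∈ c.supp, K.Reachable v r) ∧
      ((r = none ∧ K = H) ∨
        ∃ x b, r = some x ∧ H.Adj (some x) b ∧ K = H.deleteEdges {s(some x, b)} ∧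
          c ≠ H.connectedComponentMk none) := by
    intro c
    by_cases hc : c = H.connectedComponentMk none
    · refine ⟨none, H, le_rfl, hc.symm, h0 c hc, fun v hv => ?_, Or.inl ⟨rfl, rfl⟩⟩
      rw [← SimpleGraph.ConnectedComponent.eq]
      exact hv.trans hc
    · obtain ⟨a, b, hab, hac, hcyc, hr⟩ := exists_cut_of_existsUnique (h1 c hc)
      cases a with
      | none => exact absurd hac.symm hc
      | some x => exact ⟨_, _, H.deleteEdges_le _, hac, hcyc, hr, Or.inr ⟨x, b, rfl, hab, rfl, hc⟩⟩
  choose r K hKH hrc hcyc hreach hcase using hdata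
  -- the next vertex towards the root of the component, or along the cut edge
  have hnext : ∀ v : V, ∃ o : Option V, H.Adj (some v) o ∧
      ((some v ≠ r (H.connectedComponentMk (some v)) ∧
        (K (H.connectedComponentMk (some v))).Adj (some v) o ∧
        (K (H.connectedComponentMk (some v))).dist o (r (H.connectedComponentMk (some v))) <
        (K (H.connectedComponentMk (some v))).dist (some v)
          (r (H.connectedComponentMk (some v)))) ∨
      (some v = r (H.connectedComponentMk (some v)) ∧
        K (H.connectedComponentMk (some v)) = H.deleteEdges {s(some v, o)})) := by
    intro v
    set c := H.connectedComponentMk (some v) with hc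
    by_cases hv : some v = r c
    · rcases hcase c with ⟨h, -⟩ | ⟨x, b, hx, hb, hK, -⟩
      · rw [h] at hv
        exact absurd hv (Option.some_ne_none v)
      · rw [← hx, ← hv] at hb hK
        exact ⟨b, hb, Or.inr ⟨hv, hK⟩⟩
    · obtain ⟨u, hu, hd⟩ := exists_adj_dist_lt (hreach c (some v) rfl) hv
      exact ⟨u, hKH c hu, Or.inl ⟨hv, hu, hd⟩⟩
  choose F hFadj hF using hnext
  have hcomp : ∀ {a b : Option V}, H.Adj a b →
      H.connectedComponentMk a = H.connectedComponentMk b := fun hab =>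
    SimpleGraph.ConnectedComponent.eq.2 hab.reachable
  have hno : NoTwoCycle F := by
    intro v u hvu huv
    have hadj := hFadj v
    have h2 := hF v
    have h3 := hF u
    rw [hvu] at hadj h2
    rw [huv, ← hcomp hadj] at h3
    set c := H.connectedComponentMk (some v)
    rcases h2 with ⟨h4, h5, h6⟩ | ⟨h4, h5⟩ <;> rcases h3 with ⟨h7, h8, h9⟩ | ⟨h7, h8⟩
    · exact lt_asymm h6 h9
    · rw [h8, SimpleGraph.deleteEdges_adj] at h5
      exact h5.2 Sym2.eq_swap
    · rw [h5, SimpleGraph.deleteEdges_adj] at h8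
      exact h8.2 Sym2.eq_swap
    · exact hadj.ne (h4.trans h7.symm)
  have hle : mapGraph F ≤ H := (mapGraph_le_iff hno).2 hFadj
  refine ⟨F, hno, le_antisymm hle fun a b hab => ?_⟩
  -- An edge of `H` missed by `F` is not the cut edge, so it lies in `K c`. Following `F`, both its
  -- ends reach the root without using it, so it lies on a cycle of `K c`, which has none in this
  -- component.
  by_contra hnot
  set c := H.connectedComponentMk a with hc
  have hKab : (K c).Adj a b := by
    rcases hcase c with ⟨-, hK⟩ | ⟨x, -, hx, -⟩
    · rwa [hK]
    · have hxc : H.connectedComponentMk (some x) = c := by rw [← hx, hrc]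
      have h2 := hF x
      rw [hxc, hx] at h2
      rcases h2 with ⟨h3, -⟩ | ⟨-, h3⟩
      · exact absurd rfl h3
      · rw [h3, SimpleGraph.deleteEdges_adj]
        refine ⟨hab, fun hmem => hnot ?_⟩
        have h4 := mapGraph_adj_self hno x
        rcases Sym2.eq_iff.1 (Set.mem_singleton_iff.1 hmem) with ⟨rfl, rfl⟩ | ⟨rfl, rfl⟩
        · exact h4
        · exact h4.symm
  have hroot : ∀ (n : ℕ) (o : Option V), H.connectedComponentMk o = c →
      (K c).dist o (r c) = n → ((K c).deleteEdges {s(a, b)}).Reachable o (r c) := by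
    intro n
    induction n using Nat.strong_induction_on with
    | _ n ih =>
    intro o ho hn
    by_cases hor : o = r c
    · rw [hor]
    cases o with
    | none =>
      rcases hcase c with ⟨h, -⟩ | ⟨_, _, -, -, -, hx⟩
      · exact absurd h.symm hor
      · exact absurd ho.symm hx
    | some v =>
      have h2 := hF v
      rw [ho] at h2
      rcases h2 with ⟨-, h3, h4⟩ | ⟨h3, -⟩
      · refine SimpleGraph.Reachable.trans (SimpleGraph.Adj.reachable ?_)
          (ih _ (hn ▸ h4) (F v) ((hcomp (hFadj v)).symm.trans ho) rfl)
        rw [SimpleGraph.deleteEdges_adj]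
        refine ⟨h3, fun hmem => hnot ?_⟩
        have h5 := mapGraph_adj_self hno v
        rcases Sym2.eq_iff.1 (Set.mem_singleton_iff.1 hmem) with ⟨rfl, h6⟩ | ⟨rfl, h6⟩
        · rwa [h6] at h5
        · rw [h6] at h5
          exact h5.symm
      · exact absurd h3 hor
  have hr := (hroot _ a rfl rfl).trans (hroot _ b (hcomp hab).symm rfl).symm
  obtain ⟨u, p, hp, hmem⟩ :=
    SimpleGraph.adj_and_reachable_delete_edges_iff_exists_cycle.1 ⟨hKab, hr⟩
  have ha : a ∈ p.support := p.fst_mem_support_of_mem_edges hmem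
  have h2 := hcyc c
  rw [Set.eq_empty_iff_forall_notMem] at h2
  exact h2 _ ⟨a, rfl, p.rotate a ha, (SimpleGraph.Walk.isCycle_rotate ha).2 hp, rfl⟩

end Orientation

/-! ### A simple cycle winds at most once around the cylinder -/

section Winding

/-- The four unit steps: right, up, left, down. -/
def dirVec (n : ℕ) (D : Fin 4) : ZMod n × ℤ :=
  ![(1, 0), (0, 1), (-1, 0), (0, -1)] D

/-- The horizontal displacement of a unit step. -/
def dirH (D : Fin 4) : ℤ := ![1, 0, -1, 0] D

theorem dirVec_add_two (n : ℕ) (D : Fin 4) : dirVec n (D + 2) = -dirVec n D := by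
  fin_cases D <;> simp [dirVec]

theorem one_ne_zero_zmod {n : ℕ} (hn : 3 ≤ n) : (1 : ZMod n) ≠ 0 := by
  have : Fact (1 < n) := ⟨by omega⟩
  exact one_ne_zero

theorem neg_one_ne_one_zmod {n : ℕ} (hn : 3 ≤ n) : (-1 : ZMod n) ≠ 1 := by
  have : Fact (2 < n) := ⟨by omega⟩
  exact ZMod.neg_one_ne_one

theorem dirVec_injective {n : ℕ} (hn : 3 ≤ n) : Function.Injective (dirVec n) := by
  have h1 := one_ne_zero_zmod hn
  have h2 := neg_one_ne_one_zmod hn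
  intro D D' h
  fin_cases D <;> fin_cases D' <;>
    simp_all [dirVec, Prod.ext_iff, eq_comm]

/-- The four faces around a vertex of a simple closed curve take two consecutive values, so the
lower value next to the incoming edge and next to the outgoing edge agree. -/
theorem face_min_eq {a b c d : ℤ} {o w : Fin 4} (how : o ≠ w)
    (h0 : a - b = (if o = 0 then 1 else 0) - (if w = 0 then 1 else 0))
    (h1 : d - a = (if o = 1 then 1 else 0) - (if w = 1 then 1 else 0))
    (h2 : c - d = (if o = 2 then 1 else 0) - (if w = 2 then 1 else 0))
    (h3 : b - c = (if o = 3 then 1 else 0) - (if w = 3 then 1 else 0)) :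
    (![min a b, min a d, min c d, min b c] : Fin 4 → ℤ) o =
      (![min a b, min a d, min c d, min b c] : Fin 4 → ℤ) w := by
  fin_cases o <;> fin_cases w <;> simp at how h0 h1 h2 h3 ⊢ <;> omega

variable {n : ℕ}

/-- The contribution of a step `D` from `p` to the crossings of the vertical ray below height `y`
between the columns `x` and `x + 1`. -/
def crossing (x : ZMod n) (y : ℤ) (p : ZMod n × ℤ) (D : Fin 4) : ℤ :=
  (if D = 0 ∧ p.1 = x ∧ p.2 < y then 1 else 0) - (if D = 2 ∧ p.1 = x + 1 ∧ p.2 < y then 1 else 0)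

/-- The signed number of passages of a step `D'` from `p` along the edge from `u` in
direction `D`. -/
def passage (u : ZMod n × ℤ) (D : Fin 4) (p : ZMod n × ℤ) (D' : Fin 4) : ℤ :=
  (if p = u ∧ D' = D then 1 else 0) - (if p = u + dirVec n D ∧ D' = D + 2 then 1 else 0)

/-- Raising the end of the ray past height `y` adds exactly the edge from `(x, y)` to `(x + 1, y)`.
-/
theorem crossing_succ (x : ZMod n) (y : ℤ) (p : ZMod n × ℤ) (D : Fin 4) :
    crossing x (y + 1) p D - crossing x y p D = passage (x, y) 0 p D := by
  obtain ⟨a, b⟩ := p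
  fin_cases D <;> simp [crossing, passage, dirVec]
  · by_cases h : a = x <;> simp [h]
    split_ifs <;> omega
  · by_cases h : a = x + 1 <;> simp [h]
    split_ifs <;> omega

theorem passage_add (u : ZMod n × ℤ) (D : Fin 4) (p : ZMod n × ℤ) (D' : Fin 4) :
    passage (u + dirVec n D) (D + 2) p D' = -passage u D p D' := by
  have h2 : D + 2 + 2 = D := by fin_cases D <;> rfl
  simp [passage, dirVec_add_two, h2]

/-- Conservation of flow for the part of column `x` up to height `y`: what enters from the left
leaves to the right or through the top. -/
theorem crossing_column (x : ZMod n) (y : ℤ) (p : ZMod n × ℤ) (D : Fin 4) :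
    ((if (p + dirVec n D).1 = x ∧ (p + dirVec n D).2 < y + 1 then 1 else 0) -
      (if p.1 = x ∧ p.2 < y + 1 then 1 else 0) : ℤ) =
      crossing (x - 1) (y + 1) p D - crossing x (y + 1) p D - passage (x, y) 1 p D := by
  obtain ⟨a, b⟩ := p
  fin_cases D <;> simp [crossing, passage, dirVec, ← eq_sub_iff_add_eq, sub_eq_iff_eq_add]
  · by_cases h : a = x <;> simp [h]
    split_ifs <;> omega
  · by_cases h : a = x <;> simp [h]
    split_ifs <;> omega

/-- A closed simple sequence of unit steps, without immediate backtracking, winds at most once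
around the cylinder. -/
theorem exists_winding (hn : 3 ≤ n) {m : ℤ} (hm0 : 0 ≤ m) {k : ℕ} (hk : 0 < k)
    {s : ℕ → ZMod n × ℤ}
    {d : ℕ → Fin 4} (hs : ∀ i, s (i + 1) = s i + dirVec n (d i))
    (hinj : ∀ i j, s i = s j ↔ i % k = j % k) (hback : ∀ i, d (i + 1) ≠ d i + 2)
    (h0 : ∀ i, 0 ≤ (s i).2) (hm : ∀ i, (s i).2 < m) :
    ∃ w : ℤ, |w| ≤ 1 ∧ ∑ i ∈ Finset.range k, dirH (d i) = n * w := by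
  have : NeZero n := ⟨by omega⟩
  have hd : ∀ i j, i % k = j % k → d i = d j := by
    intro i j hij
    apply dirVec_injective hn
    have h1 := hs i
    have h2 := hs j
    rw [(hinj i j).2 hij, (hinj (i + 1) (j + 1)).2 (Nat.ModEq.add_right 1 hij), h2] at h1
    exact (add_left_cancel h1).symm
  have hsk : s k = s 0 := (hinj k 0).2 (by simp)
  -- `f x y` is a height function on faces, attached to the face just below the edge from `(x, y)`
  -- to `(x + 1, y)`. Across an edge it jumps by the net flow `J` of the curve along that edge.
  set f : ZMod n → ℤ → ℤ := fun x y => ∑ i ∈ Finset.range k, crossing x y (s i) (d i) with hf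
  set J : ZMod n × ℤ → Fin 4 → ℤ := fun u D =>
    ∑ i ∈ Finset.range k, passage u D (s i) (d i) with hJ
  have hJadd : ∀ u D, J (u + dirVec n D) (D + 2) = -J u D := by
    intro u D
    simp only [hJ, passage_add, Finset.sum_neg_distrib]
  have hEast : ∀ x y, f x (y + 1) - f x y = J (x, y) 0 := by
    intro x y
    simp only [hf, hJ, ← Finset.sum_sub_distrib, crossing_succ]
  have hNorth : ∀ x y, f (x - 1) (y + 1) - f x (y + 1) = J (x, y) 1 := by
    intro x y
    have h1 := Finset.sum_range_sub
      (fun i => (if (s i).1 = x ∧ (s i).2 < y + 1 then 1 else 0 : ℤ)) k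
    simp only [hs, crossing_column, Finset.sum_sub_distrib] at h1
    rw [hsk, sub_self] at h1
    simp only [hf, hJ]
    linarith
  have hWest : ∀ x y, f (x - 1) y - f (x - 1) (y + 1) = J (x, y) 2 := by
    intro x y
    have h1 := hJadd (x - 1, y) 0
    have h2 : ((x - 1, y) : ZMod n × ℤ) + dirVec n 0 = (x, y) := by simp [dirVec]
    rw [h2] at h1
    have h3 := hEast (x - 1) y
    change J (x, y) 2 = _ at h1
    linarith
  have hSouth : ∀ x y, f x y - f (x - 1) y = J (x, y) 3 := by
    intro x y
    have h1 := hJadd (x, y - 1) 1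
    have h2 : ((x, y - 1) : ZMod n × ℤ) + dirVec n 1 = (x, y) := by simp [dirVec]
    rw [h2] at h1
    have h3 := hNorth x (y - 1)
    rw [sub_add_cancel] at h3
    change J (x, y) 3 = _ at h1
    linarith
  -- The curve is simple, so each period sees this vertex once, with one outgoing direction and one
  -- incoming edge, which lies in direction `d i + 2` from the vertex.
  have hvert : ∀ i D, J (s (i + 1)) D =
      (if d (i + 1) = D then 1 else 0) - (if d i + 2 = D then 1 else 0) := by
    intro i D
    have hcount : ∀ (j₀ : ℕ) (P : Fin 4 → Prop) [DecidablePred P],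
        ∑ j ∈ Finset.range k, (if j % k = j₀ % k ∧ P (d j) then 1 else 0 : ℤ) =
          if P (d j₀) then 1 else 0 := by
      intro j₀ P _
      rw [Finset.sum_eq_single (j₀ % k)]
      · rw [Nat.mod_mod, hd (j₀ % k) j₀ (Nat.mod_mod _ _)]
        simp
      · intro j hj hne
        rw [Nat.mod_eq_of_lt (Finset.mem_range.1 hj)]
        simp [hne]
      · intro h
        exact absurd (Finset.mem_range.2 (Nat.mod_lt _ hk)) h
    simp only [hJ, passage, Finset.sum_sub_distrib]
    congr 1
    · rw [← hcount (i + 1) (fun e => e = D)]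
      refine Finset.sum_congr rfl fun j _ => ?_
      exact if_congr (and_congr_left fun _ => hinj _ _) rfl rfl
    · have h2 : D + 2 + 2 = D := by fin_cases D <;> rfl
      have h3 : ∀ e : Fin 4, e = D + 2 ↔ e + 2 = D := by
        intro e; fin_cases e <;> fin_cases D <;> decide
      rw [← hcount i (fun e => e + 2 = D)]
      refine Finset.sum_congr rfl fun j _ => if_congr ?_ rfl rfl
      rw [h3]
      refine and_congr_left fun hj => ?_
      have h4 : dirVec n D = -dirVec n (d j) := by rw [← hj, dirVec_add_two]
      rw [h4, ← sub_eq_add_neg, eq_sub_iff_add_eq, ← hs, hinj]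
      exact ⟨fun h => Nat.ModEq.add_right_cancel' 1 h, fun h => Nat.ModEq.add_right 1 h⟩
  -- the lower of the two faces next to the edge leaving `u` in direction `D`
  set lab : ZMod n × ℤ → Fin 4 → ℤ := fun u =>
    ![min (f u.1 (u.2 + 1)) (f u.1 u.2), min (f u.1 (u.2 + 1)) (f (u.1 - 1) (u.2 + 1)),
      min (f (u.1 - 1) u.2) (f (u.1 - 1) (u.2 + 1)), min (f u.1 u.2) (f (u.1 - 1) u.2)] with hlab
  have hlabrev : ∀ u D, lab (u + dirVec n D) (D + 2) = lab u D := by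
    rintro ⟨x, y⟩ D
    fin_cases D <;> simp [hlab, dirVec, min_comm, sub_eq_add_neg]
  -- By `face_min_eq` the lower of the two faces beside the curve does not change from one edge to
  -- the next. Hence the face values change across a horizontal edge only between `c` and `c + 1`,
  -- with one `c` for the whole curve.
  have hconst : ∀ i, lab (s i) (d i) = lab (s 0) (d 0) := by
    intro i
    induction i with
    | zero => rfl
    | succ i ih =>
      rw [← ih, ← hlabrev (s i) (d i), ← hs]
      have hv := hvert i
      refine face_min_eq (hback i) ?_ ?_ ?_ ?_
      · rw [hEast, Prod.mk.eta, hv]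
      · rw [hNorth, Prod.mk.eta, hv]
      · rw [hWest, Prod.mk.eta, hv]
      · rw [hSouth, Prod.mk.eta, hv]
  set c := lab (s 0) (d 0) with hc
  have hJle : ∀ i D, |J (s i) D| ≤ 1 := by
    intro i D
    have h1 : s i = s ((i + k - 1) + 1) := by
      rw [hinj, Nat.sub_add_cancel (by omega)]
      simp
    rw [h1, hvert]
    split_ifs <;> simp
  have hedge : ∀ x y, f x (y + 1) ≠ f x y → (f x y = c ∧ f x (y + 1) = c + 1) ∨
      (f x y = c + 1 ∧ f x (y + 1) = c) := by
    intro x y hne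
    have h1 : J (x, y) 0 ≠ 0 := by rw [← hEast]; exact sub_ne_zero.2 hne
    obtain ⟨i, -, hi⟩ := Finset.exists_ne_zero_of_sum_ne_zero h1
    have h2 := hEast x y
    have h3 : |J (x, y) 0| ≤ 1 ∧ min (f x (y + 1)) (f x y) = c := by
      by_cases hcase : s i = (x, y) ∧ d i = 0
      · have h4 := hconst i
        rw [hcase.1, hcase.2] at h4
        exact ⟨hcase.1 ▸ hJle i 0, h4⟩
      · have hcase' : s i = (x, y) + dirVec n 0 ∧ d i = 0 + 2 := by
          by_contra h
          simp only [passage, if_neg hcase, if_neg h] at hi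
          exact hi rfl
        have h4 := hconst i
        rw [hcase'.1, hcase'.2, hlabrev] at h4
        refine ⟨?_, h4⟩
        have h5 := hJle i 2
        rw [hcase'.1] at h5
        have h6 := hJadd (x, y) 0
        change J _ 2 = _ at h6
        rw [h6, abs_neg] at h5
        exact h5
    obtain ⟨h3, h4⟩ := h3
    rw [← h2, abs_le] at h3
    omega
  have hbot : ∀ x, f x 0 = 0 := by
    intro x
    refine Finset.sum_eq_zero fun i _ => ?_
    have := h0 i
    simp [crossing, not_lt.2 this]
  -- Going up a column from the value zero at the bottom, the first jump forces zero to be `c` or `c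
  -- + 1`; all values then have modulus at most one.
  have hbound : ∀ x, ∀ y : ℕ, f x y = 0 ∨
      ((f x y = c ∨ f x y = c + 1) ∧ (c = 0 ∨ c = -1)) := by
    intro x y
    induction y with
    | zero => exact Or.inl (by simpa using hbot x)
    | succ y ih =>
      push_cast
      by_cases hne : f x (y + 1) = f x y
      · rwa [hne]
      · have := hedge x y hne
        omega
  have htop : ∀ x, f x m = f (x - 1) m := by
    intro x
    have h1 : J (x, m) 3 = 0 := by
      rw [hJ]
      refine Finset.sum_eq_zero fun i _ => ?_
      have h2 := hm i
      have h3 := hm (i + 1)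
      rw [hs] at h3
      have h4 : ¬ (s i = (x, m) ∧ d i = 3) := by
        rintro ⟨h, -⟩
        rw [h] at h2
        exact lt_irrefl _ h2
      have h5 : ¬ (s i = (x, m) + dirVec n 3 ∧ d i = 3 + 2) := by
        rintro ⟨h, h'⟩
        rw [h', dirVec_add_two, h, add_neg_cancel_right] at h3
        exact lt_irrefl _ h3
      simp only [passage, if_neg h4, if_neg h5, sub_zero]
    have := hSouth x m
    linarith
  have htop' : ∀ x, f x m = f 0 m := by
    have h1 : ∀ j : ℕ, f (j : ZMod n) m = f 0 m := by
      intro j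
      induction j with
      | zero => simp
      | succ j ih => rw [htop, ← ih]; simp
    intro x
    rw [← ZMod.natCast_zmod_val x]
    exact h1 _
  -- Above the curve the height function no longer depends on the column, and its value is the
  -- winding number: summed over the columns, the crossings count every horizontal step once.
  refine ⟨f 0 m, ?_, ?_⟩
  · obtain ⟨M, rfl⟩ := Int.eq_ofNat_of_zero_le hm0
    have := hbound 0 M
    rw [abs_le]
    omega
  · have h1 : ∑ x : ZMod n, f x m = n * f 0 m := by
      simp [htop', ZMod.card]
    rw [← h1]
    simp only [hf]
    rw [Finset.sum_comm]
    refine Finset.sum_congr rfl fun i _ => ?_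
    have h2 := hm i
    simp only [crossing, h2, and_true, Finset.sum_sub_distrib]
    generalize d i = D
    have h3 : ∀ x, (s i).1 = x + 1 ↔ (s i).1 - 1 = x := fun x => sub_eq_iff_eq_add.symm
    simp only [h3]
    fin_cases D <;> simp [dirH]

end Winding

/-! ### Contractibility is vanishing of the horizontal displacement -/

section Contractible

variable {n m : ℕ}

/-- The horizontal displacement of a walk in the universal cover. -/
def hTotal : {u v : CylVertex n m} → (cylGrid n m).Walk u v → ℤ
  | _, _, .nil => 0
  | u, _, .cons (v := w) _ p => hStep u w + hTotal p

/-- Each edge lifts to a segment of the line of signed length `hStep / n`; concatenation adds these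
lengths. -/
theorem exists_lift_walkPath {u v : CylVertex n m} (p : (cylGrid n m).Walk u v) (a : ℝ)
    (ha : ((a : ℝ) : UnitAddCircle) = (((u.1.val : ℝ) / n : ℝ) : UnitAddCircle)) :
    ∃ γ : Path a (a + (hTotal p : ℝ) / n),
      ∀ t, ((γ t : ℝ) : UnitAddCircle) = (walkPath p t).1 := by
  induction p generalizing a with
  | nil =>
    refine ⟨(Path.refl a).cast rfl (by simp [hTotal]), fun t => ?_⟩
    exact ha
  | @cons u w v h p ih =>
    have ha' : ((a + (hStep u w : ℝ) / n : ℝ) : UnitAddCircle) =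
        (((w.1.val : ℝ) / n : ℝ) : UnitAddCircle) := by
      rw [AddCircle.coe_add, ha, angle_hStep h]
    obtain ⟨γ, hγ⟩ := ih _ ha'
    let ε : Path a (a + (hStep u w : ℝ) / n) :=
      { toFun := fun t => a + (t : ℝ) * ((hStep u w : ℝ) / n)
        continuous_toFun := by fun_prop
        source' := by simp
        target' := by simp }
    refine ⟨(ε.trans γ).cast rfl (by simp only [hTotal]; push_cast; ring), fun t => ?_⟩
    have hε : ∀ t, ((ε t : ℝ) : UnitAddCircle) = (edgePath h t).1 := by
      intro t
      change ((a + (t : ℝ) * ((hStep u w : ℝ) / n) : ℝ) : UnitAddCircle) = _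
      rw [AddCircle.coe_add, ha]
      rfl
    simp only [Path.cast_coe, walkPath, Path.trans_apply]
    split_ifs
    · exact hε _
    · exact hγ _

/-- If the loop is null-homotopic, its angular part lifts, with endpoints fixed, through the
covering of the circle by the line, so the lift is closed. Conversely a closed lift contracts in the
line; its image and a contraction of the height coordinate combine to a homotopy on the cylinder. -/
theorem isContractible_iff (hn : 0 < n) {v : CylVertex n m} (p : (cylGrid n m).Walk v v) :
    IsContractible p ↔ hTotal p = 0 := by
  obtain ⟨γ, hγ⟩ := exists_lift_walkPath p ((v.1.val : ℝ) / n) rfl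
  have hn' : (n : ℝ) ≠ 0 := by positivity
  have hcov : IsCoveringMap ((↑) : ℝ → UnitAddCircle) := AddCircle.isCoveringMap_coe 1
  constructor
  · intro h
    have h1 := h.map (ContinuousMap.fst (α := UnitAddCircle) (β := ℝ))
    have h2 := (hcov.homotopicRel_iff_comp (f₀ := γ.toContinuousMap)
      (f₁ := ContinuousMap.const _ ((v.1.val : ℝ) / n)) (S := {0, 1})
      ⟨0, Or.inl rfl, by simp⟩).2 (by
        have e1 : (⟨((↑) : ℝ → UnitAddCircle), hcov.continuous⟩ : C(ℝ, UnitAddCircle)).comp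
            γ.toContinuousMap = ((walkPath p).map continuous_fst).toContinuousMap :=
          ContinuousMap.ext hγ
        rw [e1]
        exact h1)
    obtain ⟨G⟩ := h2
    have h3 := G.eq_fst 0 (x := 1) (Or.inr rfl)
    have h4 := G.eq_snd 0 (x := 1) (Or.inr rfl)
    rw [h3] at h4
    have h5 : (v.1.val : ℝ) / n + (hTotal p : ℝ) / n = (v.1.val : ℝ) / n := by simpa using h4
    have h6 : (hTotal p : ℝ) / n = 0 := by linarith
    rcases div_eq_zero_iff.1 h6 with h7 | h7
    · exact_mod_cast h7
    · exact absurd h7 hn'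
  · intro h
    have hend : (v.1.val : ℝ) / n + (hTotal p : ℝ) / n = (v.1.val : ℝ) / n := by simp [h]
    have h1 : (γ.cast rfl hend.symm).Homotopic (Path.refl _) :=
      SimplyConnectedSpace.paths_homotopic _ _
    have h2 : ((walkPath p).map continuous_snd).Homotopic (Path.refl _) :=
      SimplyConnectedSpace.paths_homotopic _ _
    have h3 := h1.map ⟨((↑) : ℝ → UnitAddCircle), AddCircle.continuous_mk' 1⟩
    obtain ⟨H1⟩ := h3
    obtain ⟨H2⟩ := h2
    refine ⟨(Path.Homotopic.prodHomotopy H1 H2).cast ?_ ?_⟩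
    · ext t
      · exact hγ t
      · rfl
    · ext t <;> rfl

theorem hTotal_eq_sum {u v : CylVertex n m} (p : (cylGrid n m).Walk u v) :
    hTotal p = ∑ i ∈ Finset.range p.length, hStep (p.getVert i) (p.getVert (i + 1)) := by
  induction p with
  | nil => rfl
  | cons h p ih =>
    rw [hTotal, ih, SimpleGraph.Walk.length_cons, Finset.sum_range_succ', add_comm]
    simp

end Contractible

/-! ### The determinant of the wired grid counts incompressible forests -/

section Counting

variable {n m : ℕ}

theorem cylGrid_adj_iff (hn : 3 ≤ n) {u v : CylVertex n m} : (cylGrid n m).Adj u v ↔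
    ((v.1 = u.1 + 1 ∨ u.1 = v.1 + 1) ∧ u.2 = v.2) ∨
      ((u.2.val + 1 = v.2.val ∨ v.2.val + 1 = u.2.val) ∧ u.1 = v.1) := by
  have h1 := one_ne_zero_zmod hn
  simp only [cylGrid, SimpleGraph.boxProd_adj, SimpleGraph.circulantGraph,
    SimpleGraph.fromRel_adj, Set.mem_singleton_iff, SimpleGraph.pathGraph_adj]
  have h2 : (u.1 ≠ v.1 ∧ (u.1 - v.1 = 1 ∨ v.1 - u.1 = 1)) ↔
      (v.1 = u.1 + 1 ∨ u.1 = v.1 + 1) := by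
    rw [sub_eq_iff_eq_add', sub_eq_iff_eq_add', or_comm]
    refine ⟨fun h => h.2, fun h => ⟨fun he => ?_, h⟩⟩
    rw [he] at h
    simp [h1] at h
  rw [h2]

/-- For `n ≥ 3` the steps right and left are different, so the displacement changes sign when an
edge is reversed. -/
theorem exists_dir (hn : 3 ≤ n) {u v : CylVertex n m} (h : (cylGrid n m).Adj u v) :
    ∃ D : Fin 4, ((v.1, (v.2.val : ℤ)) : ZMod n × ℤ) = (u.1, (u.2.val : ℤ)) + dirVec n D ∧
      hStep u v = dirH D ∧ hStep v u = -dirH D := by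
  have h1 := one_ne_zero_zmod hn
  have h2 : ∀ a : ZMod n, a ≠ a + 1 + 1 := by
    intro a ha
    apply neg_one_ne_one_zmod hn
    have h3 : (1 : ZMod n) + 1 = 0 := by
      rw [add_assoc] at ha
      exact left_eq_add.1 ha
    exact (eq_neg_of_add_eq_zero_left h3).symm
  rcases (cylGrid_adj_iff hn).1 h with ⟨h3 | h3, h4⟩ | ⟨h3 | h3, h4⟩
  · refine ⟨0, ?_, ?_, ?_⟩
    · simp [dirVec, h3, h4]
    · simp [hStep, dirH, h3, h1]
    · simp [hStep, dirH, h3, h1, h2]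
  · refine ⟨2, ?_, ?_, ?_⟩
    · simp [dirVec, h3, h4]
    · simp [hStep, dirH, h3, h1, h2]
    · simp [hStep, dirH, h3, h1]
  · refine ⟨1, ?_, ?_, ?_⟩
    · simp [dirVec, ← h3, h4]
    · simp [hStep, dirH, h4]
    · simp [hStep, dirH, h4]
  · refine ⟨3, ?_, ?_, ?_⟩
    · simp [dirVec, ← h3, h4]
    · simp [hStep, dirH, h4]
    · simp [hStep, dirH, h4]

theorem hStep_swap (hn : 3 ≤ n) {u v : CylVertex n m} (h : (cylGrid n m).Adj u v) :
    hStep v u = -hStep u v := by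
  obtain ⟨D, -, h1, h2⟩ := exists_dir hn h
  rw [h1, h2]

/-- The horizontal displacement along the cycle of `F` through `x`. -/
def cycTotal (F : CylVertex n m → Option (CylVertex n m)) (x : CylVertex n m) : ℤ :=
  ∑ i ∈ Finset.range (cycLen F x), hStep ((totMap F)^[i] x) ((totMap F)^[i + 1] x)

theorem cycTotal_iterate {F : CylVertex n m → Option (CylVertex n m)} {x : CylVertex n m}
    (hx : IsCyc F x) (j : ℕ) : cycTotal F ((totMap F)^[j] x) = cycTotal F x := by
  induction j with
  | zero => rfl
  | succ j ih =>
    rw [← ih]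
    have hc := hx.isCyc_iterate j
    rw [Function.iterate_succ_apply']
    generalize (totMap F)^[j] x = y at hc
    have h1 := hc.cycLen_iterate 1
    rw [Function.iterate_one] at h1
    simp only [cycTotal, h1, ← Function.iterate_succ_apply]
    have h2 := Finset.sum_range_succ
      (fun i => hStep ((totMap F)^[i] y) ((totMap F)^[i + 1] y)) (cycLen F y)
    rw [Finset.sum_range_succ'] at h2
    have h3 : (totMap F)^[cycLen F y + 1] y = totMap F y := by
      rw [Function.iterate_succ_apply', hc.iterate_cycLen]
    rw [h3, hc.iterate_cycLen] at h2
    exact add_right_cancel h2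

theorem IsCyc.adj_iterate {F : CylVertex n m → Option (CylVertex n m)} (hF : NoTwoCycle F)
    (hle : mapGraph F ≤ wiredGrid n m) {x : CylVertex n m} (hx : IsCyc F x) (i : ℕ) :
    (cylGrid n m).Adj ((totMap F)^[i] x) ((totMap F)^[i + 1] x) := by
  have h1 := hle (mapGraph_adj_self hF ((totMap F)^[i] x))
  rw [hx.map_iterate i] at h1
  exact h1

/-- Over one minimal period the orbit is simple, and the absence of two-cycles excludes
backtracking, so `exists_winding` applies. -/
theorem exists_winding_cycTotal (hn : 3 ≤ n) {F : CylVertex n m → Option (CylVertex n m)}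
    (hF : NoTwoCycle F) (hle : mapGraph F ≤ wiredGrid n m) {x : CylVertex n m}
    (hx : IsCyc F x) : ∃ w : ℤ, |w| ≤ 1 ∧ cycTotal F x = n * w := by
  choose d hd1 hd2 hd3 using fun i => exists_dir hn (hx.adj_iterate hF hle i)
  have hpos : ∀ u v : CylVertex n m, ((u.1, (u.2.val : ℤ)) : ZMod n × ℤ) = (v.1, (v.2.val : ℤ)) →
      u = v := by
    rintro ⟨a, b⟩ ⟨a', b'⟩ h
    simp only [Prod.mk.injEq, Nat.cast_inj] at h
    exact Prod.ext h.1 (Fin.ext h.2)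
  obtain ⟨w, hw, hsum⟩ := exists_winding hn (m := m) (by positivity) hx.cycLen_pos
    (s := fun i => (((totMap F)^[i] x).1, (((totMap F)^[i] x).2.val : ℤ))) (d := d) hd1
    (by
      intro i j
      constructor
      · intro h
        have h1 := hpos _ _ h
        rw [← hx.iterate_mod i, ← hx.iterate_mod j] at h1
        exact hx.iterate_injOn (Nat.mod_lt _ hx.cycLen_pos) (Nat.mod_lt _ hx.cycLen_pos) h1
      · intro h
        have h1 : (totMap F)^[i] x = (totMap F)^[j] x := by
          rw [← hx.iterate_mod i, h, hx.iterate_mod j]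
        simp only [h1])
    (by
      intro i h
      have h1 := hd1 (i + 1)
      rw [hd1 i, h, dirVec_add_two, add_neg_cancel_right] at h1
      have h2 := hpos _ _ h1
      have h3 := hx.map_iterate (i + 1)
      rw [h2] at h3
      exact hF _ _ (hx.map_iterate i) h3)
    (by intro i; positivity)
    (by
      intro i
      have := ((totMap F)^[i] x).2.isLt
      exact Nat.cast_lt.2 this)
  refine ⟨w, hw, ?_⟩
  rw [← hsum, cycTotal]
  exact Finset.sum_congr rfl fun i _ => hd2 i

theorem hTotal_eq_cycTotal (hn : 3 ≤ n) {F : CylVertex n m → Option (CylVertex n m)}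
    (hF : NoTwoCycle F) {v : CylVertex n m}
    {p : (cylGrid n m).Walk v v} (hp : p.IsCycle)
    (hedge : ∀ e ∈ p.edges, e.map some ∈ (mapGraph F).edgeSet) :
    IsCyc F v ∧ (hTotal p = cycTotal F v ∨ hTotal p = -cycTotal F v) := by
  obtain ⟨x, hx, hc, hlen, h⟩ := isCyc_of_isCycle hF (Option.some_injective _) hp (by
    intro i hi
    have h1 : s(p.getVert i, p.getVert (i + 1)) ∈ p.edges := by
      rw [SimpleGraph.Walk.mk_mem_edges_iff_exists]
      exact ⟨i, hi, rfl⟩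
    exact hedge _ h1)
  obtain rfl : v = x := Option.some_injective _ hx
  refine ⟨hc, ?_⟩
  rw [hTotal_eq_sum, cycTotal, hlen]
  rcases h with h | h
  · left
    refine Finset.sum_congr rfl fun i hi => ?_
    have hi' := Finset.mem_range.1 hi
    rw [Option.some_injective _ (h i hi'.le), Option.some_injective _ (h (i + 1) hi')]
  · right
    rw [← Finset.sum_range_reflect, ← Finset.sum_neg_distrib]
    refine Finset.sum_congr rfl fun i hi => ?_
    have hi' := Finset.mem_range.1 hi
    have h1 := Option.some_injective _ (h i hi'.le)
    have h2 := Option.some_injective _ (h (i + 1) hi')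
    have h3 := p.adj_getVert_succ (i := p.length - 1 - i) (by omega)
    have e1 : p.length - 1 - i + 1 = p.length - i := by omega
    have e2 : p.length - 1 - i = p.length - (i + 1) := by omega
    rw [e1, e2] at h3 ⊢
    rw [← h1, ← h2, hStep_swap hn h3, neg_neg]

theorem isIncompressible_mapGraph_iff (hn : 3 ≤ n)
    {F : CylVertex n m → Option (CylVertex n m)} (hF : NoTwoCycle F)
    (hle : mapGraph F ≤ wiredGrid n m) :
    IsIncompressible (mapGraph F) ↔ ∀ x, IsCyc F x → cycTotal F x ≠ 0 := by
  constructor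
  · intro h x hx h0
    obtain ⟨p, hp⟩ := exists_isCycle_cycGraph hF hx
    have hsub : cycGraph F x ≤ cylGrid n m := by
      intro a b hab
      rw [cycGraph, SimpleGraph.fromEdgeSet_adj] at hab
      obtain ⟨⟨i, hi⟩, -⟩ := hab
      have h1 := hx.adj_iterate hF hle i
      rcases Sym2.eq_iff.1 hi with ⟨rfl, rfl⟩ | ⟨rfl, rfl⟩
      · exact h1
      · exact h1.symm
    have hq : (p.mapLe hsub).IsCycle := (SimpleGraph.Walk.isCycle_mapLe hsub).2 hp
    have hedge : ∀ e ∈ (p.mapLe hsub).edges, e.map some ∈ (mapGraph F).edgeSet := by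
      intro e he
      rw [SimpleGraph.Walk.edges_mapLe_eq_edges] at he
      have h1 := p.edges_subset_edgeSet he
      rw [cycGraph, SimpleGraph.edgeSet_fromEdgeSet] at h1
      obtain ⟨⟨i, rfl⟩, -⟩ := h1
      rw [Sym2.map_mk, SimpleGraph.mem_edgeSet, mapGraph_adj_some hF]
      exact Or.inl (hx.map_iterate i)
    refine h x _ hq hedge ((isContractible_iff (by omega) _).2 ?_)
    obtain ⟨-, h2⟩ := hTotal_eq_cycTotal hn hF hq hedge
    rw [h0, neg_zero, or_self] at h2
    exact h2
  · intro h v p hp hedge hcon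
    rw [isContractible_iff (by omega)] at hcon
    obtain ⟨hc, h2⟩ := hTotal_eq_cycTotal hn hF hp hedge
    rw [hcon, eq_comm, @eq_comm ℤ 0, neg_eq_zero, or_self] at h2
    exact h v hc h2

/-- The flat connection with parallel transport `ζ` along every step to the right. -/
def conn (n m : ℕ) (ζ : ℂ) (u v : CylVertex n m) : ℂ := ζ ^ hStep u v

theorem conn_mul_conn (hn : 3 ≤ n) {ζ : ℂ} (hζ : ζ ≠ 0) {u v : CylVertex n m}
    (h : (cylGrid n m).Adj u v) : conn n m ζ u v * conn n m ζ v u = 1 := by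
  rw [conn, conn, hStep_swap hn h, zpow_neg, mul_inv_cancel₀ (zpow_ne_zero _ hζ)]

theorem holonomy_conn {ζ : ℂ} (hζ : ζ ≠ 0) (F : CylVertex n m → Option (CylVertex n m))
    (x : CylVertex n m) : holonomy (conn n m ζ) F x = ζ ^ cycTotal F x := by
  unfold holonomy conn cycTotal
  induction cycLen F x with
  | zero => simp
  | succ k ih => rw [Finset.prod_range_succ, Finset.sum_range_succ, zpow_add₀ hζ, ih]

theorem mapSubgraphs_wiredGrid [NeZero n] :
    mapSubgraphs (wiredGrid n m) = {H | IsEssentialCRSF n m H} := by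
  ext H
  constructor
  · rintro ⟨F, hF, rfl, hle⟩
    exact ⟨hle, fun c hc => cyclesThrough_mapGraph_root hF hc,
      fun c hc => cyclesThrough_mapGraph_nonroot hF hc⟩
  · rintro ⟨hle, h0, h1⟩
    obtain ⟨F, hF, rfl⟩ := exists_mapGraph_eq h0 h1
    exact ⟨F, hF, rfl, hle⟩

open Classical in
-- A loop of total displacement zero has holonomy one and contributes a zero factor. The others wind
-- once in one of the two directions, and the factor is unchanged when the holonomy is inverted.
theorem det_lap_essential [NeZero n] (hn : 3 ≤ n) {ζ : ℂ} (hζ : ζ ≠ 0)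
    {H : SimpleGraph (WiredVertex n m)} (hH : IsEssentialCRSF n m H) :
    (lap (conn n m ζ) H).det =
      if IsIncompressible H then (2 - ζ ^ n - (ζ ^ n)⁻¹) ^ numLoops H else 0 := by
  have hmem : H ∈ mapSubgraphs (wiredGrid n m) := by rw [mapSubgraphs_wiredGrid]; exact hH
  obtain ⟨F, hF, rfl, hle⟩ := hmem
  rw [det_lap_mapGraph hF fun v u hvu => conn_mul_conn hn hζ (by
    have h1 := hle (mapGraph_adj_self hF v)
    rwa [hvu] at h1)]
  simp only [holonomy_conn hζ]
  split_ifs with hI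
  · rw [isIncompressible_mapGraph_iff hn hF hle] at hI
    rw [numLoops_mapGraph hF, ← Finset.prod_const]
    refine Finset.prod_congr rfl fun x hx => ?_
    have hc := (mem_cycReps.1 hx).1
    obtain ⟨w, hw, hT⟩ := exists_winding_cycTotal hn hF hle hc
    have hw0 : w ≠ 0 := by
      rintro rfl
      exact hI x hc (by simpa using hT)
    have hw1 : w = 1 ∨ w = -1 := by
      rw [abs_le] at hw
      omega
    rcases hw1 with rfl | rfl
    · rw [hT, mul_one, zpow_natCast]
    · rw [hT, mul_neg_one, zpow_neg, zpow_natCast, inv_inv]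
      ring
  · rw [isIncompressible_mapGraph_iff hn hF hle] at hI
    push Not at hI
    obtain ⟨x, hx, h0⟩ := hI
    obtain ⟨i, hi⟩ := hx.exists_mem_cycReps
    refine Finset.prod_eq_zero hi ?_
    have h1 : cycTotal F ((totMap F)^[i] x) = 0 := by
      rw [cycTotal_iterate hx, h0]
    rw [h1]
    norm_num

/-- The determinant of the bundle Laplacian generates the incompressible forests by their number
of loops. -/
theorem det_lap_wiredGrid [NeZero n] (hn : 3 ≤ n) {ζ : ℂ} (hζ : ζ ≠ 0) :
    (lap (conn n m ζ) (wiredGrid n m)).det =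
      ∑ H ∈ (Set.toFinite (incompressibleCRSFs n m)).toFinset,
        (2 - ζ ^ n - (ζ ^ n)⁻¹) ^ numLoops H := by
  classical
  rw [det_lap_eq_sum_mapSubgraphs fun v u h => conn_mul_conn hn hζ h]
  symm
  refine Finset.sum_subset_zero_on_sdiff ?_ ?_ ?_
  · intro H hH
    simp only [Set.Finite.mem_toFinset, mapSubgraphs_wiredGrid] at hH ⊢
    exact hH.1
  · intro H hH
    simp only [Finset.mem_sdiff, Set.Finite.mem_toFinset, mapSubgraphs_wiredGrid] at hH
    rw [det_lap_essential hn hζ hH.1, if_neg fun h => hH.2 ⟨hH.1, h⟩]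
  · intro H hH
    simp only [Set.Finite.mem_toFinset] at hH
    rw [det_lap_essential hn hζ hH.1, if_pos hH.2]

end Counting

/-! ### Evaluation of the determinant of the wired grid -/

section Evaluation

variable {n m : ℕ}

/-- Row `y` is read at position `y + 1`, so that positions `0` and `m + 1` are virtual rows outside
the grid; vanishing there removes the boundary cases. -/
theorem sum_fin_eq_succ (y : Fin m) (T : ℕ → ℂ) (hT : T (m + 1) = 0) :
    ∑ b : Fin m, (if y.val + 1 = b.val then T (b.val + 1) else 0) = T (y.val + 2) := by
  by_cases h : y.val + 1 < m
  · rw [Finset.sum_eq_single ⟨y.val + 1, h⟩]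
    · simp
    · intro b _ hb
      rw [if_neg fun h' => hb (Fin.ext h'.symm)]
    · simp
  · have : y.val + 2 = m + 1 := by omega
    rw [this, hT]
    refine Finset.sum_eq_zero fun b _ => if_neg fun h' => ?_
    omega

theorem sum_fin_succ_eq (y : Fin m) (T : ℕ → ℂ) (hT : T 0 = 0) :
    ∑ b : Fin m, (if b.val + 1 = y.val then T (b.val + 1) else 0) = T y.val := by
  by_cases h : 0 < y.val
  · rw [Finset.sum_eq_single ⟨y.val - 1, by omega⟩]
    · simp [Nat.sub_add_cancel h]
    · intro b _ hb
      rw [if_neg fun h' => hb (Fin.ext (by simp; omega))]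
    · simp
  · have : y.val = 0 := by omega
    rw [this, hT]
    exact Finset.sum_eq_zero fun b _ => if_neg (by omega)

open Classical in
/-- The weighted sum over the neighbours in the grid of a function vanishing on the rows just
outside. -/
theorem sum_conn_adj [NeZero n] (hn : 3 ≤ n) (ζ : ℂ) (v : CylVertex n m) (T : ZMod n → ℕ → ℂ)
    (h0 : ∀ a, T a 0 = 0) (hm : ∀ a, T a (m + 1) = 0) :
    ∑ u : CylVertex n m, (if (cylGrid n m).Adj v u then conn n m ζ v u else 0) *
        T u.1 (u.2.val + 1) =
      ζ * T (v.1 + 1) (v.2.val + 1) + ζ⁻¹ * T (v.1 - 1) (v.2.val + 1) +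
        T v.1 (v.2.val + 2) + T v.1 v.2.val := by
  obtain ⟨x, y⟩ := v
  have h1 := one_ne_zero_zmod hn
  have h2 : x + 1 ≠ x - 1 := by
    intro h
    apply neg_one_ne_one_zmod hn
    rw [sub_eq_add_neg] at h
    exact (add_left_cancel h).symm
  have hpt : ∀ u : CylVertex n m,
      (if (cylGrid n m).Adj (x, y) u then conn n m ζ (x, y) u else 0) * T u.1 (u.2.val + 1) =
      (if x + 1 = u.1 then (if y = u.2 then ζ * T u.1 (u.2.val + 1) else 0) else 0) +
      (if x - 1 = u.1 then (if y = u.2 then ζ⁻¹ * T u.1 (u.2.val + 1) else 0) else 0) +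
      (if x = u.1 then (if y.val + 1 = u.2.val then T u.1 (u.2.val + 1) else 0) else 0) +
      (if x = u.1 then (if u.2.val + 1 = y.val then T u.1 (u.2.val + 1) else 0) else 0) := by
    rintro ⟨a, b⟩
    have hx1 : x + 1 ≠ x := by simpa using h1
    have hx2 : x - 1 ≠ x := by simpa using h1
    have hsub : x = a + 1 ↔ a = x - 1 := by rw [eq_sub_iff_add_eq, eq_comm]
    simp only [cylGrid_adj_iff hn, hsub, conn, hStep]
    by_cases ha1 : a = x + 1
    · subst ha1
      simp [h2, h2.symm, hx1, hx1.symm]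
    · by_cases ha2 : a = x - 1
      · subst ha2
        simp [h2, h2.symm, hx2, hx2.symm]
      · by_cases ha3 : a = x
        · subst ha3
          simp only [ha1, ha2, Ne.symm ha1, Ne.symm ha2, false_or, or_self, false_and, if_false,
            and_true, if_true, zpow_zero, zero_add, ite_mul, one_mul, zero_mul]
          split_ifs <;> first | omega | simp
        · simp [ha1, ha2, Ne.symm ha1, Ne.symm ha2, Ne.symm ha3]
  rw [Finset.sum_congr rfl fun u _ => hpt u]
  simp only [Finset.sum_add_distrib, Fintype.sum_prod_type, Finset.sum_ite_irrel,
    Finset.sum_const_zero, Finset.sum_ite_eq, Finset.mem_univ, if_true]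
  rw [sum_fin_eq_succ y (T x) (hm x), sum_fin_succ_eq y (T x) (h0 x)]

open Classical in
-- A vertex of an extreme row exchanges one grid neighbour for the wired vertex. With `2 ≤ m` the
-- two extreme rows differ, so this happens only once.
theorem card_nbrs_wiredGrid [NeZero n] (hn : 3 ≤ n) (hm : 2 ≤ m) (v : CylVertex n m) :
    ((nbrs (wiredGrid n m) v).card : ℂ) = 4 := by
  have h1 : ((nbrs (wiredGrid n m) v).card : ℂ) =
      ∑ o : WiredVertex n m, if (wiredGrid n m).Adj (some v) o then 1 else 0 := by
    rw [Finset.card_eq_sum_ones, Nat.cast_sum, ← Finset.sum_filter]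
    refine Finset.sum_congr ?_ fun _ _ => by simp
    ext o
    simp [mem_nbrs]
  -- With trivial connection and the indicator of the actual rows, the neighbour sum counts the grid
  -- neighbours.
  have h2 := sum_conn_adj hn 1 v (fun _ r => if 1 ≤ r ∧ r ≤ m then 1 else 0) (by simp) (by simp)
  have h3 : ∀ u : CylVertex n m, (if (cylGrid n m).Adj v u then conn n m 1 v u else 0) *
      (if 1 ≤ u.2.val + 1 ∧ u.2.val + 1 ≤ m then 1 else 0) =
      if (cylGrid n m).Adj v u then (1 : ℂ) else 0 := by
    intro u
    have := u.2.isLt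
    simp [conn, this]
  rw [Finset.sum_congr rfl fun u _ => h3 u] at h2
  have h4 : ∀ u : CylVertex n m, (wiredGrid n m).Adj (some v) (some u) ↔ (cylGrid n m).Adj v u :=
    fun u => Iff.rfl
  have h5 : (wiredGrid n m).Adj (some v) none ↔ (v.2.val = 0 ∨ v.2.val + 1 = m) := Iff.rfl
  rw [h1, Fintype.sum_option]
  simp only [h4, h5, h2]
  have hy := v.2.isLt
  have h6 : (1 ≤ v.2.val + 1 ∧ v.2.val + 1 ≤ m) := by omega
  rw [if_pos h6]
  by_cases ha : v.2.val = 0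
  · have h7 : 1 ≤ v.2.val + 2 ∧ v.2.val + 2 ≤ m := by omega
    have h8 : ¬ (1 ≤ v.2.val ∧ v.2.val ≤ m) := by omega
    rw [if_pos (Or.inl ha), if_pos h7, if_neg h8]
    norm_num
  · have h8 : 1 ≤ v.2.val ∧ v.2.val ≤ m := by omega
    rw [if_pos h8]
    by_cases hb : v.2.val + 1 = m
    · have h7 : ¬ (1 ≤ v.2.val + 2 ∧ v.2.val + 2 ≤ m) := by omega
      rw [if_pos (Or.inr hb), if_neg h7]
      norm_num
    · have h7 : 1 ≤ v.2.val + 2 ∧ v.2.val + 2 ≤ m := by omega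
      rw [if_neg (by tauto), if_pos h7]
      norm_num

/-- The bundle Laplacian of the wired grid acting on a function that vanishes on the rows just
outside. -/
theorem lap_wiredGrid_mul [NeZero n] (hn : 3 ≤ n) (hm : 2 ≤ m) (ζ : ℂ) (v : CylVertex n m)
    (T : ZMod n → ℕ → ℂ) (h0 : ∀ a, T a 0 = 0) (h1 : ∀ a, T a (m + 1) = 0) :
    ∑ u : CylVertex n m, lap (conn n m ζ) (wiredGrid n m) v u * T u.1 (u.2.val + 1) =
      4 * T v.1 (v.2.val + 1) - (ζ * T (v.1 + 1) (v.2.val + 1) +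
        ζ⁻¹ * T (v.1 - 1) (v.2.val + 1) + T v.1 (v.2.val + 2) + T v.1 v.2.val) := by
  classical
  rw [← sum_conn_adj hn ζ v T h0 h1]
  simp only [lap, sub_mul, Finset.sum_sub_distrib, card_nbrs_wiredGrid hn hm]
  congr 1
  · simp
  · refine Finset.sum_congr rfl fun u _ => ?_
    congr 1
    exact if_congr mem_nbrs rfl rfl

/-! ### Diagonalisation of the Laplacian and the product formula -/

/-- The angles of the Dirichlet eigenfunctions of the path. -/
def theta (m k : ℕ) : ℝ := Real.pi * (k + 1) / (m + 1)

theorem theta_mem {k : ℕ} (hk : k < m) : 0 < theta m k ∧ theta m k < Real.pi := by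
  have hπ := Real.pi_pos
  have hk' : (k : ℝ) < m := by exact_mod_cast hk
  unfold theta
  constructor
  · positivity
  · rw [div_lt_iff₀ (by positivity)]
    nlinarith

/-- The matrix of characters of `ZMod n`. -/
def charMatrix (n : ℕ) [NeZero n] : Matrix (ZMod n) (ZMod n) ℂ := fun x j =>
  ZMod.stdAddChar (j * x)

/-- The matrix of Dirichlet eigenfunctions of the path. -/
def sineMatrix (m : ℕ) : Matrix (Fin m) (Fin m) ℂ := fun y k =>
  ((Real.sin (theta m k * (y.val + 1 : ℕ)) : ℝ) : ℂ)

/-- Columns that are eigenvectors for distinct eigenvalues are independent. It is applied to the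
cyclic shift for characters and to the adjacency matrix of the path for sines. -/
theorem det_ne_zero_of_eigen {ι : Type*} [Fintype ι] [DecidableEq ι] (A U : Matrix ι ι ℂ)
    (μ : ι → ℂ) (hμ : Function.Injective μ) (hU : ∀ i, (fun j => U j i) ≠ 0)
    (h : ∀ i j, ∑ l, A j l * U l i = μ i * U j i) : U.det ≠ 0 := by
  have h1 : LinearIndependent ℂ U.col := by
    refine Module.End.eigenvectors_linearIndependent' (Matrix.toLin' A) μ hμ _ fun i => ?_
    refine ⟨Module.End.mem_eigenspace_iff.2 ?_, hU i⟩
    ext j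
    simpa [Matrix.mulVec, dotProduct, Matrix.col] using h i j
  rw [Matrix.linearIndependent_cols_iff_isUnit, Matrix.isUnit_iff_isUnit_det] at h1
  exact h1.ne_zero

theorem det_charMatrix_ne_zero [NeZero n] : (charMatrix n).det ≠ 0 := by
  refine det_ne_zero_of_eigen (fun x x' => if x + 1 = x' then 1 else 0) _
    (fun j => ZMod.stdAddChar j) ZMod.injective_stdAddChar ?_ ?_
  · intro i h
    have := congrFun h 0
    simp [charMatrix] at this
  · intro i j
    simp [charMatrix, mul_add, AddChar.map_add_eq_mul, mul_comm]

theorem sin_theta_add (t : ℝ) (y : ℕ) :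
    Real.sin (t * (y + 2 : ℕ)) + Real.sin (t * y) =
      2 * Real.cos t * Real.sin (t * (y + 1 : ℕ)) := by
  have h1 : t * (y + 2 : ℕ) = t * (y + 1 : ℕ) + t := by push_cast; ring
  have h2 : t * (y : ℕ) = t * (y + 1 : ℕ) - t := by push_cast; ring
  rw [h1, h2, Real.sin_add, Real.sin_sub]
  ring

theorem sin_theta_top (m k : ℕ) : Real.sin (theta m k * (m + 1 : ℕ)) = 0 := by
  have h : theta m k * (m + 1 : ℕ) = (k + 1 : ℕ) * Real.pi := by
    unfold theta
    push_cast
    field_simp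
  rw [h, Real.sin_nat_mul_pi]

theorem det_sineMatrix_ne_zero : (sineMatrix m).det ≠ 0 := by
  refine det_ne_zero_of_eigen (fun y y' => (if y.val + 1 = y'.val then 1 else 0) +
    (if y'.val + 1 = y.val then 1 else 0)) _
    (fun k => ((2 * Real.cos (theta m k) : ℝ) : ℂ)) ?_ ?_ ?_
  · intro k k' h
    have h1 : Real.cos (theta m k) = Real.cos (theta m k') := by
      have := Complex.ofReal_injective h
      linarith
    have h2 := theta_mem k.isLt
    have h3 := theta_mem k'.isLt
    have h4 := Real.injOn_cos ⟨h2.1.le, h2.2.le⟩ ⟨h3.1.le, h3.2.le⟩ h1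
    unfold theta at h4
    have hπ := Real.pi_pos
    field_simp at h4
    have h5 : (k.val : ℝ) = k'.val := by linarith
    exact Fin.ext (by exact_mod_cast h5)
  · intro k h
    have h1 := congrFun h ⟨0, by have := k.isLt; omega⟩
    have h2 := theta_mem k.isLt
    simp only [sineMatrix, Pi.zero_apply, Complex.ofReal_eq_zero] at h1
    norm_num at h1
    exact (Real.sin_pos_of_pos_of_lt_pi h2.1 h2.2).ne' h1
  · intro k y
    simp only [add_mul, Finset.sum_add_distrib, ite_mul, one_mul, zero_mul, sineMatrix]
    rw [sum_fin_eq_succ y (fun r => ((Real.sin (theta m k * (r : ℕ)) : ℝ) : ℂ))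
        (by rw [sin_theta_top, Complex.ofReal_zero]),
      sum_fin_succ_eq y (fun r => ((Real.sin (theta m k * (r : ℕ)) : ℝ) : ℂ)) (by simp),
      ← Complex.ofReal_add, sin_theta_add, Complex.ofReal_mul]

theorem det_lap_eq_prod [NeZero n] (hn : 3 ≤ n) (hm : 2 ≤ m) (ζ : ℂ) :
    (lap (conn n m ζ) (wiredGrid n m)).det = ∏ k : Fin m, ∏ j : ZMod n,
      ((4 - 2 * Real.cos (theta m k) : ℝ) - ζ * ZMod.stdAddChar j -
        ζ⁻¹ * ZMod.stdAddChar (-j)) := by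
  set U := Matrix.kroneckerMap (fun a b => a * b) (charMatrix n) (sineMatrix m) with hU
  have hdet : U.det ≠ 0 := by
    rw [hU, Matrix.det_kronecker]
    exact mul_ne_zero (pow_ne_zero _ det_charMatrix_ne_zero)
      (pow_ne_zero _ det_sineMatrix_ne_zero)
  have h : lap (conn n m ζ) (wiredGrid n m) * U = U * Matrix.diagonal fun jk : CylVertex n m =>
      ((4 - 2 * Real.cos (theta m jk.2) : ℝ) - ζ * ZMod.stdAddChar jk.1 -
        ζ⁻¹ * ZMod.stdAddChar (-jk.1) : ℂ) := by
    ext v ⟨j, k⟩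
    rw [Matrix.mul_diagonal, Matrix.mul_apply]
    have h1 := lap_wiredGrid_mul hn hm ζ v
      (fun a r => ZMod.stdAddChar (j * a) * ((Real.sin (theta m k * (r : ℕ)) : ℝ) : ℂ))
      (by simp) (by intro a; rw [sin_theta_top, Complex.ofReal_zero, mul_zero])
    refine h1.trans ?_
    have h2 := congrArg (fun t : ℝ => (t : ℂ)) (sin_theta_add (theta m k) v.2.val)
    simp only [Complex.ofReal_add, Complex.ofReal_mul] at h2
    simp only [hU, Matrix.kroneckerMap_apply, charMatrix, sineMatrix, mul_add, mul_one,
      sub_eq_add_neg, mul_neg, AddChar.map_add_eq_mul]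
    push_cast at h2 ⊢
    linear_combination (-ZMod.stdAddChar (j * v.1)) * h2
  have h2 := congrArg Matrix.det h
  rw [Matrix.det_mul, Matrix.det_mul, Matrix.det_diagonal, mul_comm] at h2
  rw [mul_left_cancel₀ hdet h2, Fintype.prod_prod_type, Finset.prod_comm]

theorem prod_sub_stdAddChar [NeZero n] (x y : ℂ) :
    ∏ j : ZMod n, (x - ZMod.stdAddChar j * y) = x ^ n - y ^ n := by
  have hn0 : n ≠ 0 := NeZero.ne n
  have hprim := Complex.isPrimitiveRoot_exp n hn0
  rw [hprim.pow_sub_pow_eq_prod_sub_mul x y (Nat.pos_of_ne_zero hn0)]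
  have himg : Finset.univ.image (fun j : ZMod n => (ZMod.stdAddChar j : ℂ)) =
      Polynomial.nthRootsFinset n 1 := by
    refine Finset.eq_of_subset_of_card_le ?_ ?_
    · intro z hz
      obtain ⟨j, -, rfl⟩ := Finset.mem_image.1 hz
      rw [Polynomial.mem_nthRootsFinset (Nat.pos_of_ne_zero hn0), ← AddChar.map_nsmul_eq_pow]
      simp
    · rw [hprim.card_nthRootsFinset, Finset.card_image_of_injective _ ZMod.injective_stdAddChar,
        Finset.card_univ, ZMod.card]
  rw [← himg, Finset.prod_image fun a _ b _ h => ZMod.injective_stdAddChar h]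

/-- The exponential decay rates of the Dirichlet eigenfunctions around the cylinder. -/
def rate (m k : ℕ) : ℝ := 2 * Real.arsinh (Real.sin (theta m k / 2))

/-- `rate` is chosen so that `sinh (rate / 2) = sin (theta / 2)`; the half-angle formulas for `cosh`
and `cos` give the identity. -/
theorem two_cosh_rate (m k : ℕ) :
    2 * Real.cosh (rate m k) = 4 - 2 * Real.cos (theta m k) := by
  have h1 := Real.cosh_sq (Real.arsinh (Real.sin (theta m k / 2)))
  have h2 : Real.cos (theta m k) = 1 - 2 * Real.sin (theta m k / 2) ^ 2 := by
    have := Real.cos_two_mul (theta m k / 2)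
    rw [mul_div_cancel₀ _ two_ne_zero] at this
    rw [this, Real.cos_sq']
    ring
  rw [rate, Real.cosh_two_mul, h1, Real.sinh_arsinh, h2]
  ring

theorem det_lap_eq_prod_cosh [NeZero n] (hn : 3 ≤ n) (hm : 2 ≤ m) {ζ : ℂ} (hζ : ζ ≠ 0) :
    (lap (conn n m ζ) (wiredGrid n m)).det = ∏ k : Fin m,
      ((2 * Real.cosh (n * rate m k) : ℝ) - ζ ^ n - (ζ ^ n)⁻¹ : ℂ) := by
  rw [det_lap_eq_prod hn hm]
  refine Finset.prod_congr rfl fun k _ => ?_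
  set a : ℂ := Complex.exp (rate m k) with ha
  have ha0 : a ≠ 0 := Complex.exp_ne_zero _
  have h1 : ((4 - 2 * Real.cos (theta m k) : ℝ) : ℂ) = a + a⁻¹ := by
    rw [← two_cosh_rate, ha, ← Complex.exp_neg]
    push_cast
    rw [Complex.two_cosh]
  have h2 : ((2 * Real.cosh (n * rate m k) : ℝ) : ℂ) = a ^ n + (a ^ n)⁻¹ := by
    rw [ha, ← Complex.exp_nat_mul, ← Complex.exp_neg]
    push_cast
    rw [Complex.two_cosh]
  -- Each eigenvalue factors into terms linear in a root of unity and in its inverse, so both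
  -- products over the roots have the form `x ^ n - y ^ n`.
  have h3 : ∀ j : ZMod n, a + a⁻¹ - ζ * ZMod.stdAddChar j - ζ⁻¹ * ZMod.stdAddChar (-j) =
      (a - ZMod.stdAddChar j * ζ) * (1 - ZMod.stdAddChar (-j) * (a * ζ)⁻¹) := by
    intro j
    have h4 : ZMod.stdAddChar j * ZMod.stdAddChar (-j) = (1 : ℂ) := by
      rw [← AddChar.map_add_eq_mul, add_neg_cancel, AddChar.map_zero_eq_one]
    field_simp
    linear_combination (-ζ) * h4
  have h4 : ∏ j : ZMod n, (1 - ZMod.stdAddChar (-j) * (a * ζ)⁻¹ : ℂ) =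
      ∏ j : ZMod n, (1 - ZMod.stdAddChar j * (a * ζ)⁻¹) :=
    Equiv.prod_comp (Equiv.neg (ZMod n)) fun j => (1 - ZMod.stdAddChar j * (a * ζ)⁻¹ : ℂ)
  rw [h1, h2, Finset.prod_congr rfl fun j _ => h3 j, Finset.prod_mul_distrib,
    prod_sub_stdAddChar, h4, prod_sub_stdAddChar]
  have h5 : a ^ n ≠ 0 := pow_ne_zero _ ha0
  have h6 : ζ ^ n ≠ 0 := pow_ne_zero _ hζ
  rw [inv_pow, mul_pow, one_pow]
  field_simp
  ring

/-- Here `z` is a root of `z² - (2 - X) z + 1`, and `s` a square root of its discriminant; the two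
roots are mutually inverse. -/
theorem exists_sub_inv_eq (X : ℂ) : ∃ z : ℂ, z ≠ 0 ∧ 2 - z - z⁻¹ = X := by
  obtain ⟨s, hs⟩ := IsAlgClosed.exists_pow_nat_eq ((2 - X) ^ 2 - 4) two_pos
  have h : ((2 - X + s) / 2) * ((2 - X - s) / 2) = 1 := by linear_combination -hs / 4
  refine ⟨(2 - X + s) / 2, left_ne_zero_of_mul_eq_one h, ?_⟩
  rw [inv_eq_of_mul_eq_one_right h]
  ring

/-- The generating function of the incompressible forests by their number of loops. -/
theorem sum_pow_numLoops [NeZero n] (hn : 3 ≤ n) (hm : 2 ≤ m) (X : ℂ) :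
    ∑ H ∈ (Set.toFinite (incompressibleCRSFs n m)).toFinset, X ^ numLoops H =
      ∏ k : Fin m, ((2 * Real.cosh (n * rate m k) : ℝ) - 2 + X : ℂ) := by
  obtain ⟨z, hz, hX⟩ := exists_sub_inv_eq X
  obtain ⟨ζ, hζ⟩ := IsAlgClosed.exists_pow_nat_eq z (NeZero.pos n)
  have hζ0 : ζ ≠ 0 := by
    rintro rfl
    rw [zero_pow (NeZero.ne n)] at hζ
    exact hz hζ.symm
  have h1 := det_lap_wiredGrid (m := m) hn hζ0
  rw [det_lap_eq_prod_cosh hn hm hζ0, hζ, hX] at h1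
  rw [← h1, ← hX]
  refine Finset.prod_congr rfl fun k _ => ?_
  ring

end Evaluation

/-! ### The generating function and its limit -/

section Limit

instance (n m : ℕ) : MeasurableSingletonClass (SimpleGraph (WiredVertex n m)) :=
  ⟨fun _ => trivial⟩

variable {n m : ℕ}

theorem two_cosh_sub_one_pos (y : ℝ) : 0 < 2 * Real.cosh y - 1 := by
  have := Real.one_le_cosh y
  linarith

/-- Follows from `cosh y = 1 + 2 sinh² (y / 2)`. Quadratic growth is all that the summable
domination requires. -/
theorem one_add_sq_le_two_cosh_sub_one (y : ℝ) : 1 + y ^ 2 ≤ 2 * Real.cosh y - 1 := by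
  wlog hy : 0 ≤ y generalizing y
  · have := this (-y) (by linarith)
    rwa [Real.cosh_neg, neg_sq] at this
  have h1 : y / 2 ≤ Real.sinh (y / 2) := Real.self_le_sinh_iff.2 (by linarith)
  have h2 := Real.cosh_two_mul (y / 2)
  rw [Real.cosh_sq, mul_div_cancel₀ _ two_ne_zero] at h2
  have h3 : (y / 2) ^ 2 ≤ Real.sinh (y / 2) ^ 2 := by gcongr
  nlinarith

theorem card_incompressibleCRSFs [NeZero n] (hn : 3 ≤ n) (hm : 2 ≤ m) :
    ((Set.toFinite (incompressibleCRSFs n m)).toFinset.card : ℂ) =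
      ∏ k : Fin m, ((2 * Real.cosh (n * rate m k) - 1 : ℝ) : ℂ) := by
  have h := sum_pow_numLoops hn hm 1
  simp only [one_pow, Finset.sum_const, nsmul_eq_mul, mul_one] at h
  rw [h]
  refine Finset.prod_congr rfl fun k _ => ?_
  push_cast
  ring

/-- The cardinality is the generating function at `X = 1`, a product of positive factors. -/
theorem incompressibleCRSFs_nonempty [NeZero n] (hn : 3 ≤ n) (hm : 2 ≤ m) :
    (incompressibleCRSFs n m).Nonempty := by
  have h := card_incompressibleCRSFs hn hm
  have h1 : ((Set.toFinite (incompressibleCRSFs n m)).toFinset.card : ℂ) ≠ 0 := by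
    rw [h, Finset.prod_ne_zero_iff]
    exact fun k _ => Complex.ofReal_ne_zero.2 (two_cosh_sub_one_pos _).ne'
  rw [Nat.cast_ne_zero, Finset.card_ne_zero] at h1
  exact (Set.Finite.toFinset_nonempty _).1 h1

theorem isProbabilityMeasure_incMeasure (hn : 3 ≤ n) (hm : 2 ≤ m) :
    IsProbabilityMeasure (incMeasure n m) := by
  have : NeZero n := ⟨by omega⟩
  exact ProbabilityTheory.isProbabilityMeasure_uniformOn (Set.toFinite _)
    (incompressibleCRSFs_nonempty hn hm)

theorem loopPGF_eq_div [NeZero n] (X : ℂ) : loopPGF n m X =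
    (∑ H ∈ (Set.toFinite (incompressibleCRSFs n m)).toFinset, X ^ numLoops H) /
      (Set.toFinite (incompressibleCRSFs n m)).toFinset.card := by
  set S := (Set.toFinite (incompressibleCRSFs n m)).toFinset with hS
  have hcoe : incompressibleCRSFs n m = (S : Set _) := by simp [hS]
  have hint : IntegrableOn (fun H : SimpleGraph (WiredVertex n m) => X ^ numLoops H) (S : Set _)
      Measure.count := Integrable.integrableOn Integrable.of_finite
  rw [loopPGF, incMeasure, ProbabilityTheory.uniformOn, ProbabilityTheory.cond,
    integral_smul_measure, hcoe, setIntegral_finset _ hint, Measure.count_apply_finset]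
  simp [div_eq_inv_mul]

theorem loopPGF_eq_prod [NeZero n] (hn : 3 ≤ n) (hm : 2 ≤ m) (X : ℂ) :
    loopPGF n m X = ∏ k ∈ Finset.range m,
      (1 + (X - 1) / ((2 * Real.cosh (n * rate m k) - 1 : ℝ) : ℂ)) := by
  rw [loopPGF_eq_div, sum_pow_numLoops hn hm, card_incompressibleCRSFs hn hm,
    ← Finset.prod_div_distrib, Finset.prod_range]
  refine Finset.prod_congr rfl fun k _ => ?_
  have h : ((2 * Real.cosh (n * rate m k) - 1 : ℝ) : ℂ) ≠ 0 :=
    Complex.ofReal_ne_zero.2 (two_cosh_sub_one_pos _).ne'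
  rw [eq_comm, one_add_div h]
  congr 1
  push_cast
  ring

/-- With `0 ^ 0 = 1`, the function `0 ^ N` is the indicator of `N = 0`. -/
theorem measureReal_numLoops_eq_zero (n m : ℕ) :
    (((incMeasure n m).real {H | numLoops H = 0} : ℝ) : ℂ) = loopPGF n m 0 := by
  have h := integral_indicator_const (μ := incMeasure n m) (1 : ℂ)
    (s := {H | numLoops H = 0}) trivial
  rw [Complex.real_smul, mul_one] at h
  rw [← h, loopPGF]
  congr 1
  ext1 H
  by_cases hH : numLoops H = 0
  · simp [hH]
  · simp [hH]

/-- Jordan's inequality gives `sin (theta / 2) ≥ s`, and `arsinh s ≥ log (1 + s) ≥ s / 2` because `s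
≤ 1`. The bound is uniform in `k` and `m`. -/
theorem le_rate {k : ℕ} (hk : k < m) : ((k : ℝ) + 1) / (m + 1) ≤ rate m k := by
  have hπ := Real.pi_pos
  obtain ⟨h1, h2⟩ := theta_mem hk
  set s : ℝ := ((k : ℝ) + 1) / (m + 1) with hs
  have hs0 : 0 < s := by positivity
  have hs1 : s ≤ 1 := by
    rw [hs, div_le_one (by positivity)]
    have : (k : ℝ) < m := by exact_mod_cast hk
    linarith
  have h3 : s ≤ Real.sin (theta m k / 2) := by
    have h4 := Real.mul_le_sin (x := theta m k / 2) (by linarith) (by linarith)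
    have h5 : 2 / Real.pi * (theta m k / 2) = s := by
      rw [theta, hs]
      field_simp
    rwa [h5] at h4
  have h4 : s / 2 ≤ Real.arsinh s := by
    have h5 : 1 + s ≤ s + √(1 + s ^ 2) := by
      have : 1 ≤ √(1 + s ^ 2) := Real.one_le_sqrt.2 (by nlinarith)
      linarith
    have h6 := Real.one_sub_inv_le_log_of_pos (x := 1 + s) (by linarith)
    have h7 : Real.log (1 + s) ≤ Real.arsinh s := Real.log_le_log (by linarith) h5
    have h8 : s / 2 ≤ 1 - (1 + s)⁻¹ := by
      have h9 : 1 - (1 + s)⁻¹ = s / (1 + s) := by field_simp; ring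
      rw [h9]
      gcongr
      linarith
    linarith
  have h5 := Real.arsinh_le_arsinh.2 h3
  unfold rate
  linarith

/-- As a function of the angle the rate vanishes with slope one at zero, so for fixed `k` it may be
replaced by `theta`, and `n * theta` is `π (k + 1)` times `n / (m + 1)`. -/
theorem tendsto_mul_rate {τ : ℝ} {n m : ℕ → ℕ} (hm : Tendsto m atTop atTop)
    (hnm : Tendsto (fun i => (n i : ℝ) / (m i + 1 : ℝ)) atTop (𝓝 τ)) (k : ℕ) :
    Tendsto (fun i => (n i : ℝ) * rate (m i) k) atTop (𝓝 (Real.pi * τ * (k + 1))) := by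
  have hπ := Real.pi_pos
  have hder : HasDerivAt (fun t : ℝ => 2 * Real.arsinh (Real.sin (t / 2))) 1 0 := by
    have h1 : HasDerivAt (fun t : ℝ => t / 2) (1 / 2) 0 := (hasDerivAt_id 0).div_const 2
    have h2 := (h1.sin.arsinh).const_mul 2
    have h3 : 2 * (√(1 + Real.sin (0 / 2) ^ 2))⁻¹ • (Real.cos (0 / 2) * (1 / 2)) = (1 : ℝ) := by
      simp
    rwa [h3] at h2
  have hslope := hasDerivAt_iff_tendsto_slope_zero.1 hder
  have hmcast : Tendsto (fun i => (m i : ℝ) + 1) atTop atTop :=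
    tendsto_atTop_add_const_right _ _ (tendsto_natCast_atTop_atTop.comp hm)
  have hθ : Tendsto (fun i => theta (m i) k) atTop (𝓝[≠] 0) := by
    rw [tendsto_nhdsWithin_iff]
    refine ⟨hmcast.const_div_atTop _, Eventually.of_forall fun i => ?_⟩
    have : 0 < theta (m i) k := by unfold theta; positivity
    exact this.ne'
  have h1 := hslope.comp hθ
  have h2 : Tendsto (fun i => Real.pi * (k + 1) * ((n i : ℝ) / (m i + 1 : ℝ))) atTop
      (𝓝 (Real.pi * (k + 1) * τ)) := hnm.const_mul _
  have h3 := h2.mul h1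
  rw [mul_one] at h3
  have e : Real.pi * (k + 1) * τ = Real.pi * τ * (k + 1) := by ring
  rw [e] at h3
  refine h3.congr fun i => ?_
  have h4 : Real.pi * (k + 1) * ((n i : ℝ) / (m i + 1 : ℝ)) = n i * theta (m i) k := by
    unfold theta
    ring
  have h5 : 0 < theta (m i) k := by unfold theta; positivity
  simp only [Function.comp, zero_add, zero_div, Real.sin_zero, Real.arsinh_zero, mul_zero,
    sub_zero, smul_eq_mul]
  rw [h4, rate]
  field_simp

/-- The limiting deviations of the factors from one. -/
def limitTerm (τ : ℝ) (X : ℂ) (k : ℕ) : ℂ :=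
  (X - 1) / ((2 * Real.cosh (Real.pi * τ * (k + 1)) - 1 : ℝ) : ℂ)

theorem limitFactor_eq (τ : ℝ) (X : ℂ) (k : ℕ) :
    limitFactor τ X (k + 1) = 1 + limitTerm τ X k := by
  have h : ((2 * Real.cosh (Real.pi * τ * (k + 1)) - 1 : ℝ) : ℂ) ≠ 0 :=
    Complex.ofReal_ne_zero.2 (two_cosh_sub_one_pos _).ne'
  have h1 : ((Real.exp (Real.pi * τ) : ℂ)) ^ (k + 1) +
      (((Real.exp (Real.pi * τ) : ℂ)) ^ (k + 1))⁻¹ =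
      ((2 * Real.cosh (Real.pi * τ * (k + 1)) : ℝ) : ℂ) := by
    rw [← Complex.ofReal_pow, ← Real.exp_nat_mul, ← Complex.ofReal_inv, ← Real.exp_neg,
      ← Complex.ofReal_add, Real.cosh_eq]
    congr 1
    have : ((k + 1 : ℕ) : ℝ) * (Real.pi * τ) = Real.pi * τ * (k + 1) := by push_cast; ring
    rw [this]
    ring
  rw [limitTerm, one_add_div h, limitFactor]
  simp only [h1]
  congr 1 <;> push_cast <;> ring

theorem norm_term_le {a y : ℝ} (ha : 0 < a) (k : ℕ) (hy : a * (k + 1) ≤ y) (X : ℂ) :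
    ‖(X - 1) / ((2 * Real.cosh y - 1 : ℝ) : ℂ)‖ ≤
      ‖X - 1‖ * (a ^ 2)⁻¹ * (((k + 1 : ℕ) : ℝ) ^ 2)⁻¹ := by
  have h1 := one_add_sq_le_two_cosh_sub_one y
  have h2 : 0 < a * (k + 1) := by positivity
  have h3 : (a * (k + 1)) ^ 2 ≤ 2 * Real.cosh y - 1 := by
    have : (a * (k + 1)) ^ 2 ≤ y ^ 2 := by gcongr
    linarith
  rw [norm_div, Complex.norm_real, Real.norm_of_nonneg (two_cosh_sub_one_pos y).le, mul_assoc,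
    ← mul_inv, ← mul_pow, div_eq_mul_inv]
  push_cast
  gcongr

theorem summable_bound (C : ℝ) : Summable fun k : ℕ => C * (((k + 1 : ℕ) : ℝ) ^ 2)⁻¹ := by
  refine Summable.mul_left C ?_
  exact (summable_nat_add_iff 1).2 (Real.summable_nat_pow_inv.2 one_lt_two)

theorem summable_norm_limitTerm {τ : ℝ} (hτ : 0 < τ) (X : ℂ) :
    Summable fun k => ‖limitTerm τ X k‖ :=
  Summable.of_nonneg_of_le (fun _ => norm_nonneg _)
    (fun k => norm_term_le (a := Real.pi * τ) (mul_pos Real.pi_pos hτ) k le_rfl X)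
    (summable_bound _)

theorem tendsto_loopPGF {τ : ℝ} (hτ : 0 < τ) {n m : ℕ → ℕ} (hn : Tendsto n atTop atTop)
    (hm : Tendsto m atTop atTop)
    (hnm : Tendsto (fun k => (n k : ℝ) / (m k : ℝ)) atTop (𝓝 τ)) (X : ℂ) :
    Tendsto (fun i => loopPGF (n i) (m i) X) atTop (𝓝 (∏' k, (1 + limitTerm τ X k))) := by
  have hnm' : Tendsto (fun i => (n i : ℝ) / (m i + 1 : ℝ)) atTop (𝓝 τ) := by
    have h1 : Tendsto (fun i => (m i : ℝ) / (m i + 1 : ℝ)) atTop (𝓝 1) :=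
      tendsto_natCast_div_add_atTop (1 : ℝ) |>.comp hm
    have h2 := hnm.mul h1
    rw [mul_one] at h2
    refine h2.congr' ?_
    filter_upwards [hm.eventually_ge_atTop 1] with i hi
    have : (m i : ℝ) ≠ 0 := by positivity
    field_simp
  -- Extension by zero beyond `m i` turns the finite products into infinite ones over a common index
  -- set, ready for dominated convergence.
  set f : ℕ → ℕ → ℂ := fun i k =>
    if k < m i then (X - 1) / ((2 * Real.cosh (n i * rate (m i) k) - 1 : ℝ) : ℂ) else 0 with hf
  have hlim : ∀ k, Tendsto (fun i => f i k) atTop (𝓝 (limitTerm τ X k)) := by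
    intro k
    have h1 := tendsto_mul_rate hm hnm' k
    have h2 : Tendsto (fun i => ((2 * Real.cosh (n i * rate (m i) k) - 1 : ℝ) : ℂ)) atTop
        (𝓝 ((2 * Real.cosh (Real.pi * τ * (k + 1)) - 1 : ℝ) : ℂ)) :=
      (Complex.continuous_ofReal.tendsto _).comp
        ((((Real.continuous_cosh.tendsto _).comp h1).const_mul 2).sub_const 1)
    have h3 : Tendsto (fun i => (X - 1) / ((2 * Real.cosh (n i * rate (m i) k) - 1 : ℝ) : ℂ))
        atTop (𝓝 (limitTerm τ X k)) :=
      tendsto_const_nhds.div h2 (Complex.ofReal_ne_zero.2 (two_cosh_sub_one_pos _).ne')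
    refine h3.congr' ?_
    filter_upwards [hm.eventually_gt_atTop k] with i hi
    simp only [hf, if_pos hi]
  have hbound : ∀ᶠ i in atTop, ∀ k, ‖f i k‖ ≤
      ‖X - 1‖ * ((τ / 2) ^ 2)⁻¹ * (((k + 1 : ℕ) : ℝ) ^ 2)⁻¹ := by
    filter_upwards [hnm'.eventually_const_le (by linarith : τ / 2 < τ)] with i hi k
    simp only [hf]
    split_ifs with hk
    · refine norm_term_le (by linarith) k ?_ X
      have h1 := le_rate hk
      calc τ / 2 * (k + 1) ≤ (n i : ℝ) / (m i + 1 : ℝ) * (k + 1) := by gcongr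
        _ = n i * (((k : ℝ) + 1) / (m i + 1)) := by ring
        _ ≤ n i * rate (m i) k := by gcongr
    · rw [norm_zero]
      positivity
  have hmain := tendsto_tprod_one_add_of_dominated_convergence (summable_bound _) hlim hbound
  refine hmain.congr' ?_
  filter_upwards [hn.eventually_ge_atTop 3, hm.eventually_ge_atTop 2] with i hi hi'
  have : NeZero (n i) := ⟨by omega⟩
  rw [loopPGF_eq_prod hi hi', tprod_eq_prod (s := Finset.range (m i))]
  · refine Finset.prod_congr rfl fun k hk => ?_
    simp only [hf, if_pos (Finset.mem_range.1 hk)]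
  · intro k hk
    simp only [hf, if_neg fun h => hk (Finset.mem_range.2 h), add_zero]

/-- At `X = 0` the numerators `2 cosh - 2` are positive because the arguments are nonzero, and an
absolutely convergent product without zero factors is nonzero. -/
theorem tprod_limitTerm_ne_zero {τ : ℝ} (hτ : 0 < τ) : ∏' k, (1 + limitTerm τ 0 k) ≠ 0 := by
  refine tprod_one_add_ne_zero_of_summable (fun k => ?_) (summable_norm_limitTerm hτ 0)
  have hpos := two_cosh_sub_one_pos (Real.pi * τ * (k + 1))
  have h : ((2 * Real.cosh (Real.pi * τ * (k + 1)) - 1 : ℝ) : ℂ) ≠ 0 :=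
    Complex.ofReal_ne_zero.2 hpos.ne'
  have h1 : 1 < Real.cosh (Real.pi * τ * (k + 1)) := by
    rw [Real.one_lt_cosh]
    have := Real.pi_pos
    positivity
  rw [limitTerm, one_add_div h]
  refine div_ne_zero ?_ h
  have h2 : ((2 * Real.cosh (Real.pi * τ * (k + 1)) - 1 : ℝ) : ℂ) + (0 - 1) =
      ((2 * Real.cosh (Real.pi * τ * (k + 1)) - 2 : ℝ) : ℂ) := by
    push_cast
    ring
  rw [h2, Complex.ofReal_ne_zero]
  linarith

theorem exists_pos_of_tendsto {r : ℕ → ℝ} {P : ℂ} (hr : ∀ i, 0 ≤ r i) (hP : P ≠ 0)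
    (h : Tendsto (fun i => (r i : ℂ)) atTop (𝓝 P)) :
    ∃ c : ℝ, 0 < c ∧ (c : ℂ) = P ∧ Tendsto r atTop (𝓝 c) := by
  have hre : Tendsto r atTop (𝓝 P.re) := (Complex.continuous_re.tendsto P).comp h
  have hc : ((P.re : ℝ) : ℂ) = P :=
    tendsto_nhds_unique ((Complex.continuous_ofReal.tendsto _).comp hre) h
  refine ⟨P.re, lt_of_le_of_ne (ge_of_tendsto' hre hr) fun h0 => hP ?_, hc, hre⟩
  rw [← hc, ← h0, Complex.ofReal_zero]

end Limit

end CylCRSF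

end

theorem mainTheorem10 (τ : ℝ) (hτ : 0 < τ) (n m : ℕ → ℕ)
    (hn : Tendsto n atTop atTop) (hm : Tendsto m atTop atTop)
    (hnm : Tendsto (fun k => (n k : ℝ) / (m k : ℝ)) atTop (𝓝 τ)) :
    (∀ᶠ k in atTop, IsProbabilityMeasure (CylCRSF.incMeasure (n k) (m k))) ∧
    (∀ X : ℂ,
      Multipliable (fun j : ℕ => CylCRSF.limitFactor τ X (j + 1)) ∧
      Tendsto (fun k => CylCRSF.loopPGF (n k) (m k) X) atTop
        (𝓝 (∏' j : ℕ, CylCRSF.limitFactor τ X (j + 1)))) ∧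
    (∃ c : ℝ, 0 < c ∧ (c : ℂ) = (∏' j : ℕ, CylCRSF.limitFactor τ 0 (j + 1)) ∧
      Tendsto (fun k => (CylCRSF.incMeasure (n k) (m k)).real {H | CylCRSF.numLoops H = 0})
        atTop (𝓝 c)) := by
  simp only [CylCRSF.limitFactor_eq]
  refine ⟨?_, fun X => ⟨?_, CylCRSF.tendsto_loopPGF hτ hn hm hnm X⟩, ?_⟩
  -- From circumference 3 and height 2 on, right and left steps differ and every vertex has degree
  -- four, as the exact formula requires.
  · filter_upwards [hn.eventually_ge_atTop 3, hm.eventually_ge_atTop 2] with k hk hk'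
    exact CylCRSF.isProbabilityMeasure_incMeasure hk hk'
  · exact multipliable_one_add_of_summable (CylCRSF.summable_norm_limitTerm hτ X)
  · refine CylCRSF.exists_pos_of_tendsto (fun _ => measureReal_nonneg)
      (CylCRSF.tprod_limitTerm_ne_zero hτ) ?_
    simp only [CylCRSF.measureReal_numLoops_eq_zero]
    exact CylCRSF.tendsto_loopPGF hτ hn hm hnm 0
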